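/- Let $N\ge 1$ be an integer and $\beta\in\mathbb{C}$ with $\beta^4=(-1)^N$. Write $\{x,y\}=xy+yx$. **The Hopf algebra $H(N)$.** It is the unital associative $\mathbb{C}$-algebra generated by $k,f_1,\dots,f_N$ with relations $\{f_i,f_j\}=0$, $\{f_i,k\}=0$, $k^2=1$, with $\Delta(k)=k\otimes k$, $\Delta(f_i)=f_i\otimes k+1\otimes f_i$, $\varepsilon(k)=1$, $\varepsilon(f_i)=0$, $S(k)=k$, $S(f_i)=-f_ik$. **The Drinfeld double $D(H)$** of a finite-dimensional Hopf algebra $H$ is $H^*\otimes H$ with unit $\varepsilon\otimes 1$ and product $$(\phi\otimes a)(\psi\otimes b)=\sum_{(a)}\phi\cdot\psi\big(S^{-1}(a''')(-)a'\big)\otimes a''b,\qquad (\phi\cdot\psi)(x)=\sum_{(x)}\phi(x')\psi(x''),$$ coproduct $\Delta(\phi\otimes a)=\sum(\phi'\otimes a')\otimes(\phi''\otimes a'')$ where $\sum\phi'(x)\phi''(y)=\phi(yx)$, counit $\phi\otimes a\mapsto\phi(1)\varepsilon(a)$, antipode $S(\phi\otimes a)=(\varepsilon\otimes S(a))\cdot(\phi\circ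 S^{-1}\otimes 1)$, and R-matrix $R_D=\sum_i(\varepsilon\otimes b_i)\otimes(b_i^*\otimes 1)$ for any basis $(b_i)$ of $H$. **The quasi-Hopf algebra $\mathsf{Q}(N,\beta)$.** It is the unital associative $\mathbb{C}$-algebra generated by $\mathsf K$ and $\mathsf f_i^\pm$ ($1\le i\le N$) with relations $$\{\mathsf f_i^\pm,\mathsf K\}=0,\quad \{\mathsf f_i^+,\mathsf f_j^-\}=\delta_{ij}e_1,\quad \{\mathsf f_i^\pm,\mathsf f_j^\pm\}=0,\quad \mathsf K^4=1,\qquad e_0=\tfrac12(1+\mathsf K^2),\ e_1=\tfrac12(1-\mathsf K^2).$$ With $\omega_\pm=(e_0\pm \mathrm i e_1)\mathsf K$ its structure maps are $$\Delta(\mathsf K)=\mathsf K\otimes\mathsf K-(1+(-1)^N)\,(e_1\otimes e_1)(\mathsf K\otimes\mathsf K),\qquad \Delta(\mathsf f_i^\pm)=\mathsf f_i^\pm\otimes 1+\omega_\pm\otimes\mathsf f_i^\pm,$$ $$\varepsilon(\mathsf K)=1,\quad \varepsilon(\mathsf f_i^\pm)=0,\quad S(\mathsf K)=(e_0+(-1)^Ne_1)\mathsf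 K,\quad S(\mathsf f_i^\pm)=\mathsf f_i^\pm(e_0\pm(-1)^N\mathrm i e_1)\mathsf K,$$ its coassociator is $\Phi=1\otimes1\otimes1+e_1\otimes e_1\otimes\{(\mathsf K^N-1)e_0+(\beta^2(\mathrm i\mathsf K)^N-1)e_1\}$, and its evaluation and coevaluation elements are $1$ and $e_0+\beta^2(\mathrm i\mathsf K)^Ne_1$. Its R-matrix is $$R=\Big(\sum_{n,m\in\{0,1\}}\beta^{nm}\rho_{n,m}\,e_n\otimes e_m\Big)\prod_{k=1}^N\big(1\otimes1-2\,\mathsf f_k^-\omega_-\otimes\mathsf f_k^+\big),\qquad \rho_{n,m}=\tfrac12\sum_{i,j=0}^1(-1)^{ij}\,\mathrm i^{-in+jm}\,\mathsf K^i\otimes\mathsf K^j .$$ **Proposition.** There is a linear bijection $\Psi:D(H(N))\to\mathsf{Q}(N,\beta)$ such that: 1. $D(H(N))$ is an associative unital algebra and $\Psi$ is an isomorphism of $\mathbb{C}$-algebras. 2. If $N$ is even and $\beta=\pm1$, then $\Phi=1\otimes1\otimes1$ and the evaluation and coevaluation elements are both $1$, both $D(H(N))$ and $\mathsf{Q}(N,\beta)$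 are Hopf algebras, and $\Psi$ is an isomorphism of Hopf algebras. 3. If $N$ is even and $\beta=1$, then moreover $(D(H(N)),R_D)$ and $(\mathsf{Q}(N,\beta),R)$ are quasi-triangular Hopf algebras and $(\Psi\otimes\Psi)(R_D)=R$; that is, $\Psi$ is an isomorphism of quasi-triangular Hopf algebras. Here a universal R-matrix is an invertible $R$ with $R\,\Delta(a)=\Delta^{\mathrm{op}}(a)\,R$, $(\Delta\otimes\mathrm{id})(R)=R_{13}R_{23}$ and $(\mathrm{id}\otimes\Delta)(R)=R_{13}R_{12}$. -/

import Mathlib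

open scoped TensorProduct

/-! ## Hopf algebras and quasi-triangular Hopf algebras, as data plus axioms -/

/-- The operations of a Hopf algebra on a `k`-module `A` (without axioms). -/
structure HopfData (k : Type*) (A : Type*) [CommRing k] [AddCommGroup A] [Module k A] where
  /-- multiplication -/
  mul : A →ₗ[k] A →ₗ[k] A
  /-- unit -/
  one : A
  /-- coproduct -/
  comul : A →ₗ[k] A ⊗[k] A
  /-- counit -/
  counit : A →ₗ[k] k
  /-- antipode -/
  antipode : A →ₗ[k] A

namespace HopfData

section

variable {k : Type*} {A : Type*} {B : Type*} [CommRing k] [AddCommGroup A] [Module k A]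
  [AddCommGroup B] [Module k B]

/-- The factorwise multiplication `(a ⊗ b)(c ⊗ d) = ac ⊗ bd` on `A ⊗ A`. -/
noncomputable def mul₂ (h : HopfData k A) : A ⊗[k] A →ₗ[k] A ⊗[k] A →ₗ[k] A ⊗[k] A :=
  TensorProduct.map₂ h.mul h.mul

/-- The factorwise multiplication on `A ⊗ (A ⊗ A)`. -/
noncomputable def mul₃ (h : HopfData k A) :
    A ⊗[k] (A ⊗[k] A) →ₗ[k] A ⊗[k] (A ⊗[k] A) →ₗ[k] A ⊗[k] (A ⊗[k] A) :=
  TensorProduct.map₂ h.mul h.mul₂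

/-- `(A, mul, one)` is an associative unital `k`-algebra. -/
structure IsAlgebra (h : HopfData k A) : Prop where
  mul_assoc : ∀ a b c, h.mul (h.mul a b) c = h.mul a (h.mul b c)
  one_mul : ∀ a, h.mul h.one a = a
  mul_one : ∀ a, h.mul a h.one = a

/-- The data form a Hopf algebra over `k`. -/
structure IsHopfAlgebra (h : HopfData k A) : Prop extends h.IsAlgebra where
  /-- coassociativity -/
  coassoc : ∀ a, TensorProduct.assoc k A A A (h.comul.rTensor A (h.comul a))
    = h.comul.lTensor A (h.comul a)
  /-- left counit law -/
  counit_comul : ∀ a, TensorProduct.lid k A (h.counit.rTensor A (h.comul a)) = a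
  /-- right counit law -/
  comul_counit : ∀ a, TensorProduct.rid k A (h.counit.lTensor A (h.comul a)) = a
  /-- the coproduct is an algebra map -/
  comul_mul : ∀ a b, h.comul (h.mul a b) = h.mul₂ (h.comul a) (h.comul b)
  comul_one : h.comul h.one = h.one ⊗ₜ h.one
  /-- the counit is an algebra map -/
  counit_mul : ∀ a b, h.counit (h.mul a b) = h.counit a * h.counit b
  counit_one : h.counit h.one = 1
  /-- `∑ S(a') a'' = ε(a) 1` -/
  antipode_left : ∀ a, TensorProduct.lift h.mul (h.antipode.rTensor A (h.comul a))
    = h.counit a • h.one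
  /-- `∑ a' S(a'') = ε(a) 1` -/
  antipode_right : ∀ a, TensorProduct.lift h.mul (h.antipode.lTensor A (h.comul a))
    = h.counit a • h.one

/-- For `R = ∑ r ⊗ s`, the element `R₁₂ = ∑ r ⊗ s ⊗ 1`. -/
noncomputable def leg₁₂ (h : HopfData k A) (R : A ⊗[k] A) : A ⊗[k] (A ⊗[k] A) :=
  ((TensorProduct.mk k A A).flip h.one).lTensor A R

/-- For `R = ∑ r ⊗ s`, the element `R₁₃ = ∑ r ⊗ 1 ⊗ s`. -/
noncomputable def leg₁₃ (h : HopfData k A) (R : A ⊗[k] A) : A ⊗[k] (A ⊗[k] A) :=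
  (TensorProduct.mk k A A h.one).lTensor A R

/-- For `R = ∑ r ⊗ s`, the element `R₂₃ = ∑ 1 ⊗ r ⊗ s`. -/
noncomputable def leg₂₃ (h : HopfData k A) (R : A ⊗[k] A) : A ⊗[k] (A ⊗[k] A) :=
  h.one ⊗ₜ R

/-- The data form a Hopf algebra, and `R` is a universal R-matrix for it. -/
structure IsQuasiTriangular (h : HopfData k A) (R : A ⊗[k] A) : Prop extends
    h.IsHopfAlgebra where
  /-- `R` is invertible -/
  invertible : ∃ R' : A ⊗[k] A, h.mul₂ R R' = h.one ⊗ₜ h.one ∧ h.mul₂ R' R = h.one ⊗ₜ h.one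
  /-- `R Δ(a) = Δᵒᵖ(a) R` -/
  intertwine : ∀ a, h.mul₂ R (h.comul a) = h.mul₂ (TensorProduct.comm k A A (h.comul a)) R
  /-- `(Δ ⊗ id)(R) = R₁₃ R₂₃` -/
  hexagon_left : TensorProduct.assoc k A A A (h.comul.rTensor A R)
    = h.mul₃ (h.leg₁₃ R) (h.leg₂₃ R)
  /-- `(id ⊗ Δ)(R) = R₁₃ R₁₂` -/
  hexagon_right : h.comul.lTensor A R = h.mul₃ (h.leg₁₃ R) (h.leg₁₂ R)

/-- The linear bijection `e` is an isomorphism of unital algebras. -/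
structure IsAlgebraIso (h : HopfData k A) (h' : HopfData k B) (e : A ≃ₗ[k] B) : Prop where
  map_mul : ∀ a b, e (h.mul a b) = h'.mul (e a) (e b)
  map_one : e h.one = h'.one

/-- The linear bijection `e` is an isomorphism of Hopf algebras. -/
structure IsHopfIso (h : HopfData k A) (h' : HopfData k B) (e : A ≃ₗ[k] B) : Prop extends
    IsAlgebraIso h h' e where
  map_comul : ∀ a, TensorProduct.map e.toLinearMap e.toLinearMap (h.comul a) = h'.comul (e a)
  map_counit : ∀ a, h'.counit (e a) = h.counit a
  map_antipode : ∀ a, e (h.antipode a) = h'.antipode (e a)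

end

end HopfData

/-! ## The Drinfeld double of a finite-dimensional Hopf algebra -/

/-- The antipode of `H` is bijective. (This is automatic for finite-dimensional `H`.) -/
class HasBijectiveAntipode (k : Type*) (H : Type*) [Field k] [Ring H] [HopfAlgebra k H] :
    Prop where
  bijective : Function.Bijective (HopfAlgebra.antipode k : H →ₗ[k] H)

/-- The underlying vector space `H* ⊗ H` of the Drinfeld double. -/
abbrev DrinfeldDouble (k : Type*) (H : Type*) [Field k] [Ring H] [HopfAlgebra k H] :=
  Module.Dual k H ⊗[k] H

namespace DrinfeldDouble

open Module

section

variable (k : Type*) (H : Type*) [Field k] [Ring H] [HopfAlgebra k H]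

/-- The product of `H*`: `(φ ψ)(a) = ∑ φ(a') ψ(a'')`. -/
noncomputable def dualMul : Dual k H →ₗ[k] Dual k H →ₗ[k] Dual k H :=
  TensorProduct.curry
    (Dual.transpose (R := k) (Coalgebra.comul : H →ₗ[k] H ⊗[k] H) ∘ₗ
      TensorProduct.dualDistrib k H H)

variable {k H} in
theorem dualMul_apply (φ ψ : Dual k H) (a : H) :
    dualMul k H φ ψ a = TensorProduct.dualDistrib k H H (φ ⊗ₜ ψ) (Coalgebra.comul a) := rfl

/-- The coproduct of `(Hᵒᵖ)*`, characterised by `∑ φ'(a) φ''(b) = φ(b a)`. -/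
noncomputable def dualComul [FiniteDimensional k H] :
    Dual k H →ₗ[k] Dual k H ⊗[k] Dual k H :=
  (TensorProduct.dualDistribEquiv k H H).symm.toLinearMap ∘ₗ
    Dual.transpose (R := k)
      (LinearMap.mul' k H ∘ₗ (TensorProduct.comm k H H).toLinearMap)

variable {k H} in
theorem dualDistrib_dualComul [FiniteDimensional k H] (φ : Dual k H) (a b : H) :
    TensorProduct.dualDistrib k H H (dualComul k H φ) (a ⊗ₜ b) = φ (b * a) :=
  congrArg (fun F : Dual k (H ⊗[k] H) => F (a ⊗ₜ b))
    ((TensorProduct.dualDistribEquiv k H H).apply_symm_apply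
      (Dual.transpose (R := k) (LinearMap.mul' k H ∘ₗ (TensorProduct.comm k H H).toLinearMap) φ))

/-- The two-sided translate `ψ(c (-) d)` of a linear form, as a linear function of `c`, `d`
and `ψ`. -/
noncomputable def translate : H →ₗ[k] H →ₗ[k] (Dual k H →ₗ[k] Dual k H) :=
  LinearMap.mk₂ k
    (fun c d => Dual.transpose (R := k) (LinearMap.mulLeft k c ∘ₗ LinearMap.mulRight k d))
    (fun _ _ _ => by ext; simp [Dual.transpose_apply, add_mul])
    (fun _ _ _ => by ext; simp [Dual.transpose_apply])
    (fun _ _ _ => by ext; simp [Dual.transpose_apply, mul_add])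
    (fun _ _ _ => by ext; simp [Dual.transpose_apply])

variable {k H} in
theorem translate_apply (c d : H) (ψ : Dual k H) (x : H) :
    translate k H c d ψ x = ψ (c * (x * d)) := rfl

/-- The iterated coproduct `a ↦ ∑ a' ⊗ (a'' ⊗ a''')`. -/
noncomputable def comul₃ : H →ₗ[k] H ⊗[k] (H ⊗[k] H) :=
  (Coalgebra.comul : H →ₗ[k] H ⊗[k] H).lTensor H ∘ₗ (Coalgebra.comul : H →ₗ[k] H ⊗[k] H)

section

variable [HasBijectiveAntipode k H]

/-- The inverse `S⁻¹` of the antipode. -/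
noncomputable def antipodeInv : H →ₗ[k] H :=
  (LinearEquiv.ofBijective (HopfAlgebra.antipode k : H →ₗ[k] H)
    HasBijectiveAntipode.bijective).symm.toLinearMap

/-- `x, y, z ↦ (ψ ⊗ b ↦ ψ(S⁻¹(z) (-) x) ⊗ y b)`. -/
noncomputable def straightenAux :
    H →ₗ[k] H →ₗ[k] H →ₗ[k] (Dual k H ⊗[k] H →ₗ[k] Dual k H ⊗[k] H) :=
  LinearMap.mk₂ k
    (fun x y => (TensorProduct.mapBilinear (RingHom.id k) (Dual k H) H (Dual k H) H).flip
        (LinearMap.mulLeft k y) ∘ₗ (translate k H).flip x ∘ₗ antipodeInv k H)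
    (fun _ _ _ => by ext; simp)
    (fun _ _ _ => by ext; simp)
    (fun _ _ _ => by ext; simp [add_mul, TensorProduct.tmul_add])
    (fun _ _ _ => by ext; simp)

variable {k H} in
theorem straightenAux_apply (x y z b : H) (ψ : Dual k H) :
    straightenAux k H x y z (ψ ⊗ₜ b)
      = translate k H (antipodeInv k H z) x ψ ⊗ₜ (y * b) := rfl

/-- The action of `a ∈ H` on `H* ⊗ H` by left multiplication with `1 ⊗ a` in the double:
`ψ ⊗ b ↦ ∑ ψ(S⁻¹(a''') (-) a') ⊗ a'' b`. -/
noncomputable def straighten : H →ₗ[k] (Dual k H ⊗[k] H →ₗ[k] Dual k H ⊗[k] H) :=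
  TensorProduct.lift
    (TensorProduct.uncurry (RingHom.id k) H H _ ∘ₗ straightenAux k H) ∘ₗ
      comul₃ k H

/-- The product of the Drinfeld double:
`(φ ⊗ a)(ψ ⊗ b) = ∑ φ · ψ(S⁻¹(a''') (-) a') ⊗ a'' b`. -/
noncomputable def mul :
    DrinfeldDouble k H →ₗ[k] DrinfeldDouble k H →ₗ[k] DrinfeldDouble k H :=
  TensorProduct.lift
    (LinearMap.mk₂ k
      (fun φ a => (dualMul k H φ).rTensor H ∘ₗ straighten k H a)
      (fun _ _ _ => by simp [LinearMap.rTensor_add, LinearMap.add_comp])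
      (fun _ _ _ => by simp [LinearMap.rTensor_smul, LinearMap.smul_comp])
      (fun _ _ _ => by simp [LinearMap.comp_add])
      (fun _ _ _ => by simp [LinearMap.comp_smul]))

variable {k H} in
theorem mul_tmul_tmul {ι : Type*} (t : Finset ι) (φ ψ : Dual k H) (a b : H) (x y z : ι → H)
    (h : comul₃ k H a = ∑ i ∈ t, x i ⊗ₜ (y i ⊗ₜ z i)) :
    mul k H (φ ⊗ₜ a) (ψ ⊗ₜ b)
      = ∑ i ∈ t, dualMul k H φ (translate k H (antipodeInv k H (z i)) (x i) ψ) ⊗ₜ (y i * b) := by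
  simp [mul, straighten, h, straightenAux_apply]

end

/-- The embedding `a ↦ 1 ⊗ a` of `H`; the unit of `H*` is the counit of `H`. -/
noncomputable def inclH : H →ₗ[k] DrinfeldDouble k H :=
  TensorProduct.mk k (Dual k H) H (Coalgebra.counit : H →ₗ[k] k)

/-- The embedding `φ ↦ φ ⊗ 1` of `(Hᵒᵖ)*`. -/
noncomputable def inclDual : Dual k H →ₗ[k] DrinfeldDouble k H :=
  (TensorProduct.mk k (Dual k H) H).flip 1

/-- The Hopf algebra operations of the Drinfeld double `D(H)`: the product is `mul`, the unit is
`1 ⊗ 1`, the coproduct is `∑ (φ' ⊗ a') ⊗ (φ'' ⊗ a'')` with the coproduct of `(Hᵒᵖ)*` on the first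
factor, the counit is `φ(1) ε(a)`, and the antipode is `(1 ⊗ S(a)) · (φ ∘ S⁻¹ ⊗ 1)`. -/
noncomputable def hopfData [FiniteDimensional k H] [HasBijectiveAntipode k H] :
    HopfData k (DrinfeldDouble k H) where
  mul := mul k H
  one := inclH k H 1
  comul := (TensorProduct.tensorTensorTensorComm k (Dual k H) (Dual k H) H H).toLinearMap ∘ₗ
    TensorProduct.map (dualComul k H) (Coalgebra.comul : H →ₗ[k] H ⊗[k] H)
  counit := LinearMap.mul' k k ∘ₗ
    TensorProduct.map (Dual.eval k H 1) (Coalgebra.counit : H →ₗ[k] k)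
  antipode := TensorProduct.lift
    (((mul k H).compl₁₂ (inclH k H ∘ₗ HopfAlgebra.antipode k)
      (inclDual k H ∘ₗ Dual.transpose (R := k) (antipodeInv k H))).flip)

/-- The canonical R-matrix `∑ᵢ (1 ⊗ bᵢ) ⊗ (bᵢ* ⊗ 1)` of the Drinfeld double, for any basis `bᵢ`
of `H`. -/
noncomputable def rMatrix [FiniteDimensional k H] :
    DrinfeldDouble k H ⊗[k] DrinfeldDouble k H :=
  TensorProduct.map (inclH k H) (inclDual k H) (coevaluation k H 1)

end

end DrinfeldDouble

/-! ## The generalised Sweedler Hopf algebra `H(N)` -/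

/-- Generators of `H(N)`. -/
inductive HGen (N : ℕ) : Type
  | k : HGen N
  | f (i : Fin N) : HGen N

/-- The defining relations `{fᵢ, fⱼ} = 0`, `{fᵢ, k} = 0`, `k² = 1` of `H(N)`. -/
inductive HRel (N : ℕ) : FreeAlgebra ℂ (HGen N) → FreeAlgebra ℂ (HGen N) → Prop
  | ff (i j : Fin N) : HRel N
      (FreeAlgebra.ι ℂ (HGen.f i) * FreeAlgebra.ι ℂ (HGen.f j)
        + FreeAlgebra.ι ℂ (HGen.f j) * FreeAlgebra.ι ℂ (HGen.f i)) 0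
  | fk (i : Fin N) : HRel N
      (FreeAlgebra.ι ℂ (HGen.f i) * FreeAlgebra.ι ℂ HGen.k
        + FreeAlgebra.ι ℂ HGen.k * FreeAlgebra.ι ℂ (HGen.f i)) 0
  | kk : HRel N (FreeAlgebra.ι ℂ HGen.k * FreeAlgebra.ι ℂ HGen.k) 1

/-- The generalised Sweedler algebra `H(N)`, by generators and relations. -/
def HAlg (N : ℕ) : Type := RingQuot (HRel N)

namespace HAlg

noncomputable instance (N : ℕ) : Ring (HAlg N) := inferInstanceAs (Ring (RingQuot (HRel N)))
noncomputable instance (N : ℕ) : Algebra ℂ (HAlg N) :=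
  inferInstanceAs (Algebra ℂ (RingQuot (HRel N)))

/-- The image of a generator in `H(N)`. -/
noncomputable def gen {N : ℕ} (g : HGen N) : HAlg N :=
  RingQuot.mkAlgHom ℂ (HRel N) (FreeAlgebra.ι ℂ g)

/-- The generator `k`. -/
noncomputable def k (N : ℕ) : HAlg N := gen HGen.k

/-- The generator `fᵢ`. -/
noncomputable def f {N : ℕ} (i : Fin N) : HAlg N := gen (HGen.f i)

section

variable {N : ℕ}

theorem f_mul_f (i j : Fin N) : f i * f j + f j * f i = 0 := by
  have h := RingQuot.mkAlgHom_rel ℂ (HRel.ff i j)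
  simp only [map_add, map_mul, map_zero] at h
  exact h

theorem f_mul_k (i : Fin N) : f i * k N + k N * f i = 0 := by
  have h := RingQuot.mkAlgHom_rel ℂ (HRel.fk i)
  simp only [map_add, map_mul, map_zero] at h
  exact h

theorem k_mul_k : k N * k N = 1 := by
  have h := RingQuot.mkAlgHom_rel ℂ (HRel.kk (N := N))
  simp only [map_mul, map_one] at h
  exact h

theorem k_mul_f (i : Fin N) : k N * f i = -(f i * k N) :=
  eq_neg_of_add_eq_zero_right (f_mul_k i)

theorem f_mul_f_swap (i j : Fin N) : f j * f i = -(f i * f j) :=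
  eq_neg_of_add_eq_zero_right (f_mul_f i j)

/-- A map on generators. -/
def genMap {A : Type*} (K : A) (F : Fin N → A) : HGen N → A
  | HGen.k => K
  | HGen.f i => F i

section

variable {A : Type*} [Ring A] [Algebra ℂ A] (K : A) (F : Fin N → A)
    (hff : ∀ i j, F i * F j + F j * F i = 0) (hfk : ∀ i, F i * K + K * F i = 0)
    (hkk : K * K = 1)

theorem genMap_rel (hff : ∀ i j, F i * F j + F j * F i = 0) (hfk : ∀ i, F i * K + K * F i = 0)
    (hkk : K * K = 1) ⦃x y : FreeAlgebra ℂ (HGen N)⦄ (h : HRel N x y) :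
    FreeAlgebra.lift ℂ (genMap K F) x = FreeAlgebra.lift ℂ (genMap K F) y := by
  cases h with
  | ff i j => simpa [genMap] using hff i j
  | fk i => simpa [genMap] using hfk i
  | kk => simpa [genMap] using hkk

/-- The universal property of `H(N)`. -/
noncomputable def lift : HAlg N →ₐ[ℂ] A :=
  RingQuot.liftAlgHom ℂ ⟨FreeAlgebra.lift ℂ (genMap K F), genMap_rel K F hff hfk hkk⟩

theorem lift_gen (g : HGen N) : lift K F hff hfk hkk (gen g) = genMap K F g :=
  (RingQuot.liftAlgHom_mkAlgHom_apply ℂ _ (genMap_rel K F hff hfk hkk) _).trans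
    (FreeAlgebra.lift_ι_apply _ _)

@[simp] theorem lift_k : lift K F hff hfk hkk (k N) = K := lift_gen ..

@[simp] theorem lift_f (i : Fin N) : lift K F hff hfk hkk (f i) = F i := lift_gen ..

end

theorem algHom_ext {A : Type*} [Ring A] [Algebra ℂ A] {φ ψ : HAlg N →ₐ[ℂ] A}
    (hk : φ (k N) = ψ (k N)) (hf : ∀ i, φ (f i) = ψ (f i)) : φ = ψ := by
  refine RingQuot.ringQuot_ext' ℂ _ _ (FreeAlgebra.hom_ext (funext fun g => ?_))
  cases g with
  | k => exact hk
  | f i => exact hf i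

/-- Induction along products of generators. -/
theorem induction {P : HAlg N → Prop} (hc : ∀ c : ℂ, P (algebraMap ℂ _ c)) (hk : P (k N))
    (hf : ∀ i, P (f i)) (hmul : ∀ a b, P a → P b → P (a * b))
    (hadd : ∀ a b, P a → P b → P (a + b)) (a : HAlg N) : P a := by
  obtain ⟨x, rfl⟩ := RingQuot.mkAlgHom_surjective ℂ (HRel N) a
  induction x using FreeAlgebra.induction with
  | grade0 r => rw [AlgHom.commutes]; exact hc r
  | grade1 g =>
    cases g with
    | k => exact hk
    | f i => exact hf i
  | mul a b ha hb => rw [map_mul]; exact hmul _ _ ha hb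
  | add a b ha hb => rw [map_add]; exact hadd _ _ ha hb

/-- The coproduct: `Δ(k) = k ⊗ k`, `Δ(fᵢ) = fᵢ ⊗ k + 1 ⊗ fᵢ`. -/
noncomputable def comulHom (N : ℕ) : HAlg N →ₐ[ℂ] HAlg N ⊗[ℂ] HAlg N :=
  lift (k N ⊗ₜ k N) (fun i => f i ⊗ₜ k N + 1 ⊗ₜ f i)
    (by
      intro i j
      simp only [add_mul, mul_add, Algebra.TensorProduct.tmul_mul_tmul, one_mul, mul_one,
        k_mul_k, k_mul_f, f_mul_f_swap i j, TensorProduct.neg_tmul, TensorProduct.tmul_neg]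
      abel)
    (by
      intro i
      simp only [add_mul, mul_add, Algebra.TensorProduct.tmul_mul_tmul, one_mul, mul_one,
        k_mul_k, k_mul_f, TensorProduct.neg_tmul, TensorProduct.tmul_neg]
      abel)
    (by simp [Algebra.TensorProduct.one_def, k_mul_k])

/-- The counit: `ε(k) = 1`, `ε(fᵢ) = 0`. -/
noncomputable def counitHom (N : ℕ) : HAlg N →ₐ[ℂ] ℂ :=
  lift 1 (fun _ => 0) (by simp) (by simp) (by simp)

/-- The antipode as an algebra map to the opposite algebra: `S(k) = k`, `S(fᵢ) = -fᵢ k`. -/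
noncomputable def antipodeHom (N : ℕ) : HAlg N →ₐ[ℂ] (HAlg N)ᵐᵒᵖ :=
  lift (MulOpposite.op (k N)) (fun i => MulOpposite.op (-(f i * k N)))
    (by
      intro i j
      rw [← MulOpposite.op_mul, ← MulOpposite.op_mul, ← MulOpposite.op_add]
      refine congrArg MulOpposite.op ?_
      have h : ∀ a b : Fin N, -(f a * k N) * -(f b * k N) = -(f a * f b) := fun a b => by
        rw [neg_mul_neg, mul_assoc, ← mul_assoc (k N), k_mul_f, neg_mul, mul_assoc (f b),
          k_mul_k, mul_one, mul_neg]
      rw [h, h, f_mul_f_swap i j]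
      simp)
    (by
      intro i
      rw [← MulOpposite.op_mul, ← MulOpposite.op_mul, ← MulOpposite.op_add]
      refine congrArg MulOpposite.op ?_
      rw [neg_mul, mul_neg, ← mul_assoc, k_mul_f, neg_mul, neg_neg]
      simp [mul_assoc, k_mul_k])
    (by rw [← MulOpposite.op_mul, k_mul_k]; rfl)

@[simp] theorem comulHom_k : comulHom N (k N) = k N ⊗ₜ k N := by simp [comulHom]
@[simp] theorem comulHom_f (i : Fin N) :
    comulHom N (f i) = f i ⊗ₜ k N + 1 ⊗ₜ f i := by simp [comulHom]
@[simp] theorem counitHom_k : counitHom N (k N) = 1 := by simp [counitHom]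
@[simp] theorem counitHom_f (i : Fin N) : counitHom N (f i) = 0 := by simp [counitHom]
@[simp] theorem antipodeHom_k : antipodeHom N (k N) = MulOpposite.op (k N) := by
  simp [antipodeHom]
@[simp] theorem antipodeHom_f (i : Fin N) :
    antipodeHom N (f i) = MulOpposite.op (-(f i * k N)) := by
  simp [antipodeHom]

noncomputable instance : Bialgebra ℂ (HAlg N) :=
  Bialgebra.ofAlgHom (comulHom N) (counitHom N)
    (algHom_ext (by simp)
      (fun i => by
        simp [TensorProduct.add_tmul, TensorProduct.tmul_add, Algebra.TensorProduct.one_def,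
          add_assoc]))
    (algHom_ext (by simp) (fun i => by simp))
    (algHom_ext (by simp) (fun i => by simp))

theorem comul_apply (a : HAlg N) : Coalgebra.comul (R := ℂ) a = comulHom N a := rfl
theorem counit_apply (a : HAlg N) : Coalgebra.counit (R := ℂ) a = counitHom N a := rfl

/-- The antipode as a linear map. -/
noncomputable def antipodeLin (N : ℕ) : HAlg N →ₗ[ℂ] HAlg N :=
  (MulOpposite.opLinearEquiv ℂ).symm.toLinearMap ∘ₗ (antipodeHom N).toLinearMap

theorem antipodeLin_apply (a : HAlg N) :
    antipodeLin N a = MulOpposite.unop (antipodeHom N a) := rfl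

theorem antipodeLin_mul (a b : HAlg N) :
    antipodeLin N (a * b) = antipodeLin N b * antipodeLin N a := by
  simp [antipodeLin_apply]

@[simp] theorem antipodeLin_algebraMap (c : ℂ) :
    antipodeLin N (algebraMap ℂ _ c) = algebraMap ℂ _ c := by
  simp [antipodeLin_apply]

@[simp] theorem antipodeLin_one : antipodeLin N 1 = 1 := by
  simp [antipodeLin_apply]

@[simp] theorem antipodeLin_k : antipodeLin N (k N) = k N := by
  simp [antipodeLin_apply]

@[simp] theorem antipodeLin_f (i : Fin N) : antipodeLin N (f i) = -(f i * k N) := by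
  simp [antipodeLin_apply]

theorem antipode_left_aux (x y : HAlg N ⊗[ℂ] HAlg N) (c : ℂ)
    (hx : LinearMap.mul' ℂ _ ((antipodeLin N).rTensor _ x) = algebraMap ℂ _ c) :
    LinearMap.mul' ℂ _ ((antipodeLin N).rTensor _ (x * y))
      = c • LinearMap.mul' ℂ _ ((antipodeLin N).rTensor _ y) := by
  induction y with
  | zero => simp
  | add y z hy hz => rw [mul_add, map_add, map_add, hy, hz, map_add, map_add, smul_add]
  | tmul p q =>
    have key : LinearMap.mul' ℂ _ ((antipodeLin N).rTensor _ (x * p ⊗ₜ[ℂ] q))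
        = antipodeLin N p * LinearMap.mul' ℂ _ ((antipodeLin N).rTensor _ x) * q := by
      clear hx
      induction x with
      | zero => simp
      | add y z hy hz => simp only [add_mul, mul_add, map_add, hy, hz]
      | tmul r s => simp [antipodeLin_mul, mul_assoc]
    rw [key, hx]
    simp [Algebra.algebraMap_eq_smul_one]

theorem antipode_right_aux (x y : HAlg N ⊗[ℂ] HAlg N) (c : ℂ)
    (hy : LinearMap.mul' ℂ _ ((antipodeLin N).lTensor _ y) = algebraMap ℂ _ c) :
    LinearMap.mul' ℂ _ ((antipodeLin N).lTensor _ (x * y))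
      = c • LinearMap.mul' ℂ _ ((antipodeLin N).lTensor _ x) := by
  induction x with
  | zero => simp
  | add y z hy hz => rw [add_mul, map_add, map_add, hy, hz, map_add, map_add, smul_add]
  | tmul p q =>
    have key : LinearMap.mul' ℂ _ ((antipodeLin N).lTensor _ (p ⊗ₜ[ℂ] q * y))
        = p * LinearMap.mul' ℂ _ ((antipodeLin N).lTensor _ y) * antipodeLin N q := by
      clear hy
      induction y with
      | zero => simp
      | add y z hy hz => simp only [add_mul, mul_add, map_add, hy, hz]
      | tmul r s => simp [antipodeLin_mul, mul_assoc]
    rw [key, hy]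
    simp [Algebra.algebraMap_eq_smul_one]

noncomputable instance : HopfAlgebra ℂ (HAlg N) where
  antipode := antipodeLin N
  mul_antipode_rTensor_comul := by
    ext a
    simp only [LinearMap.comp_apply, comul_apply, counit_apply, Algebra.linearMap_apply]
    induction a using induction with
    | hc c => simp [Algebra.TensorProduct.algebraMap_apply]
    | hk => simp [k_mul_k]
    | hf i => simp [mul_assoc, k_mul_k]
    | hmul a b ha hb =>
      rw [map_mul, antipode_left_aux _ _ _ ha, hb, map_mul, map_mul, Algebra.smul_def]
    | hadd a b ha hb => simp only [map_add, ha, hb]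
  mul_antipode_lTensor_comul := by
    ext a
    simp only [LinearMap.comp_apply, comul_apply, counit_apply, Algebra.linearMap_apply]
    induction a using induction with
    | hc c => simp [Algebra.TensorProduct.algebraMap_apply]
    | hk => simp [k_mul_k]
    | hf i => simp
    | hmul a b ha hb =>
      rw [map_mul, antipode_right_aux _ _ _ hb, ha, map_mul, mul_comm, map_mul, Algebra.smul_def]
    | hadd a b ha hb => simp only [map_add, ha, hb]

theorem antipode_apply (a : HAlg N) : HopfAlgebra.antipode ℂ a = antipodeLin N a := rfl

theorem antipodeLin_four (a : HAlg N) :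
    antipodeLin N (antipodeLin N (antipodeLin N (antipodeLin N a))) = a := by
  induction a using induction with
  | hc c => simp
  | hk => simp
  | hf i => simp [antipodeLin_mul, k_mul_f, ← mul_assoc, mul_assoc (f i), k_mul_k]
  | hmul a b ha hb => simp only [antipodeLin_mul, ha, hb]
  | hadd a b ha hb => simp only [map_add, ha, hb]

instance : HasBijectiveAntipode ℂ (HAlg N) where
  bijective := by
    refine Function.bijective_iff_has_inverse.mpr
      ⟨fun a => antipodeLin N (antipodeLin N (antipodeLin N a)), fun a => ?_, fun a => ?_⟩
    · exact antipodeLin_four a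
    · exact antipodeLin_four a

/-! `H(N)` is finite-dimensional: it is spanned by the ordered monomials in the generators. -/

theorem f_mul_f_self (i : Fin N) : f i * f i = 0 := by
  have h := f_mul_f i i
  rw [← two_smul ℂ] at h
  exact (smul_eq_zero.mp h).resolve_left two_ne_zero

/-- The span of ordered products of the `fᵢ` along a list. -/
noncomputable def fSpan (l : List (Fin N)) : Submodule ℂ (HAlg N) :=
  (l.map fun i => Submodule.span ℂ {1, f i}).prod

theorem fSpan_fg (l : List (Fin N)) : (fSpan l).FG := by
  induction l with
  | nil =>
    rw [fSpan, List.map_nil, List.prod_nil, Submodule.one_eq_span]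
    exact Submodule.fg_span (Set.finite_singleton _)
  | cons i t ih =>
    rw [fSpan, List.map_cons, List.prod_cons]
    exact (Submodule.fg_span (Set.toFinite _)).mul ih

theorem one_mem_fSpan (l : List (Fin N)) : (1 : HAlg N) ∈ fSpan l := by
  induction l with
  | nil => simp [fSpan, Submodule.one_le.mp le_rfl]
  | cons i t ih =>
    rw [fSpan, List.map_cons, List.prod_cons]
    have h := Submodule.mul_mem_mul
      (Submodule.subset_span (by simp) : (1 : HAlg N) ∈ Submodule.span ℂ {1, f i}) ih
    rw [one_mul] at h
    exact h

theorem f_mul_fSpan (j : Fin N) (l : List (Fin N)) (hj : j ∈ l) :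
    Submodule.span ℂ {f j} * fSpan l ≤ fSpan l := by
  induction l with
  | nil => simp at hj
  | cons i t ih =>
    rw [fSpan, List.map_cons, List.prod_cons, ← mul_assoc]
    by_cases h : j = i
    · subst h
      refine mul_le_mul' ?_ le_rfl
      rw [Submodule.span_mul_span, Submodule.span_le]
      rintro _ ⟨a, rfl, b, rfl | rfl, rfl⟩
      · simpa using Submodule.subset_span (by simp)
      · simp [f_mul_f_self]
    · have h1 : Submodule.span ℂ {f j} * Submodule.span ℂ {1, f i}
          ≤ Submodule.span ℂ {1, f i} * Submodule.span ℂ {f j} := by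
        rw [Submodule.span_mul_span, Submodule.span_le]
        rintro _ ⟨a, rfl, b, rfl | rfl, rfl⟩
        · change f j * 1 ∈ _
          rw [mul_one, ← one_mul (f j)]
          exact Submodule.mul_mem_mul (Submodule.subset_span (by simp))
            (Submodule.subset_span (by simp))
        · change f j * f i ∈ _
          rw [f_mul_f_swap]
          exact neg_mem (Submodule.mul_mem_mul (Submodule.subset_span (by simp))
            (Submodule.subset_span (by simp)))
      refine (mul_le_mul' h1 le_rfl).trans ?_
      rw [mul_assoc]
      exact mul_le_mul' le_rfl (ih (by simpa [h] using hj))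

theorem k_mul_fSpan (l : List (Fin N)) :
    Submodule.span ℂ {k N} * fSpan l ≤ fSpan l * Submodule.span ℂ {k N} := by
  induction l with
  | nil => simp [fSpan]
  | cons i t ih =>
    rw [fSpan, List.map_cons, List.prod_cons, ← mul_assoc]
    have h1 : Submodule.span ℂ {k N} * Submodule.span ℂ {1, f i}
        ≤ Submodule.span ℂ {1, f i} * Submodule.span ℂ {k N} := by
      rw [Submodule.span_mul_span, Submodule.span_le]
      rintro _ ⟨a, rfl, b, rfl | rfl, rfl⟩
      · change k N * 1 ∈ _
        rw [mul_one, ← one_mul (k N)]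
        exact Submodule.mul_mem_mul (Submodule.subset_span (by simp))
          (Submodule.subset_span (by simp))
      · change k N * f i ∈ _
        rw [k_mul_f]
        exact neg_mem (Submodule.mul_mem_mul (Submodule.subset_span (by simp))
          (Submodule.subset_span (by simp)))
    refine (mul_le_mul' h1 le_rfl).trans ?_
    rw [mul_assoc, mul_assoc]
    exact mul_le_mul' le_rfl ih

instance : FiniteDimensional ℂ (HAlg N) := by
  let B : Submodule ℂ (HAlg N) := Submodule.span ℂ {1, k N}
  let W : Submodule ℂ (HAlg N) := fSpan (List.finRange N) * B
  have hB1 : (1 : HAlg N) ∈ B := Submodule.subset_span (by simp)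
  have h1 : (1 : HAlg N) ∈ W := by
    rw [← one_mul (1 : HAlg N)]
    exact Submodule.mul_mem_mul (one_mem_fSpan _) hB1
  have hf : ∀ i : Fin N, ∀ w ∈ W, f i * w ∈ W := by
    intro i w hw
    have := Submodule.mul_mem_mul (Submodule.mem_span_singleton_self (R := ℂ) (f i)) hw
    rw [← mul_assoc] at this
    exact mul_le_mul' (f_mul_fSpan i _ (List.mem_finRange i)) le_rfl this
  have hk : ∀ w ∈ W, k N * w ∈ W := by
    intro w hw
    have := Submodule.mul_mem_mul (Submodule.mem_span_singleton_self (R := ℂ) (k N)) hw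
    rw [← mul_assoc] at this
    have := mul_le_mul' (k_mul_fSpan _) le_rfl this
    rw [mul_assoc] at this
    suffices h : Submodule.span ℂ {k N} * B ≤ B from
      (mul_le_mul' le_rfl h : fSpan (List.finRange N) * (Submodule.span ℂ {k N} * B) ≤ W) this
    rw [Submodule.span_mul_span, Submodule.span_le]
    rintro _ ⟨a, rfl, b, rfl | rfl, rfl⟩
    · simpa using Submodule.subset_span (by simp)
    · change k N * k N ∈ _
      rw [k_mul_k]
      exact hB1
  have hall : ∀ a : HAlg N, ∀ w ∈ W, a * w ∈ W := by
    intro a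
    induction a using induction with
    | hc c => intro w hw; rw [← Algebra.smul_def]; exact W.smul_mem c hw
    | hk => exact hk
    | hf i => exact hf i
    | hmul a b ha hb => intro w hw; rw [mul_assoc]; exact ha _ (hb _ hw)
    | hadd a b ha hb => intro w hw; rw [add_mul]; exact W.add_mem (ha _ hw) (hb _ hw)
  refine ⟨?_⟩
  have hW : W = ⊤ := by
    refine eq_top_iff.mpr fun a _ => ?_
    simpa using hall a 1 h1
  rw [← hW]
  exact (fSpan_fg _).mul (Submodule.fg_span (Set.toFinite _))

end
end HAlg

/-! ## The quasi-Hopf algebra `Q(N, β)` -/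

/-- Generators of `Q(N, β)`; `f true i` is `fᵢ⁺` and `f false i` is `fᵢ⁻`. -/
inductive QGen (N : ℕ) : Type
  | K : QGen N
  | f (s : Bool) (i : Fin N) : QGen N

/-- The defining relations of `Q(N, β)`: `{fᵢ^±, K} = 0`, `{fᵢ⁺, fⱼ⁻} = δᵢⱼ ½(1 - K²)`,
`{fᵢ^±, fⱼ^±} = 0`, `K⁴ = 1`. -/
inductive QRel (N : ℕ) : FreeAlgebra ℂ (QGen N) → FreeAlgebra ℂ (QGen N) → Prop
  | fK (s : Bool) (i : Fin N) : QRel N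
      (FreeAlgebra.ι ℂ (QGen.f s i) * FreeAlgebra.ι ℂ QGen.K
        + FreeAlgebra.ι ℂ QGen.K * FreeAlgebra.ι ℂ (QGen.f s i)) 0
  | pm (i j : Fin N) : QRel N
      (FreeAlgebra.ι ℂ (QGen.f true i) * FreeAlgebra.ι ℂ (QGen.f false j)
        + FreeAlgebra.ι ℂ (QGen.f false j) * FreeAlgebra.ι ℂ (QGen.f true i))
      (if i = j then (1 / 2 : ℂ) • (1 - FreeAlgebra.ι ℂ QGen.K ^ 2) else 0)
  | ff (s : Bool) (i j : Fin N) : QRel N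
      (FreeAlgebra.ι ℂ (QGen.f s i) * FreeAlgebra.ι ℂ (QGen.f s j)
        + FreeAlgebra.ι ℂ (QGen.f s j) * FreeAlgebra.ι ℂ (QGen.f s i)) 0
  | K4 : QRel N (FreeAlgebra.ι ℂ QGen.K ^ 4) 1

/-- The algebra underlying `Q(N, β)`, by generators and relations. The parameter `β` does not
enter the relations; it enters the coassociator, the R-matrix and the coevaluation element. -/
def QAlg (N : ℕ) (_β : ℂ) : Type := RingQuot (QRel N)

namespace QAlg

noncomputable instance (N : ℕ) (β : ℂ) : Ring (QAlg N β) :=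
  inferInstanceAs (Ring (RingQuot (QRel N)))
noncomputable instance (N : ℕ) (β : ℂ) : Algebra ℂ (QAlg N β) :=
  inferInstanceAs (Algebra ℂ (RingQuot (QRel N)))

/-- The image of a generator in `Q(N, β)`. -/
noncomputable def gen {N : ℕ} {β : ℂ} (g : QGen N) : QAlg N β :=
  RingQuot.mkAlgHom ℂ (QRel N) (FreeAlgebra.ι ℂ g)

/-- The sign `±1` attached to `±`. -/
def sgn : Bool → ℂ
  | true => 1
  | false => -1

section

variable (N : ℕ) (β : ℂ)

/-- The generator `K`. -/
noncomputable def K : QAlg N β := gen QGen.K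

/-- The central idempotent `e₀ = ½(1 + K²)`. -/
noncomputable def e₀ : QAlg N β := (1 / 2 : ℂ) • (1 + K N β ^ 2)

/-- The central idempotent `e₁ = ½(1 - K²)`. -/
noncomputable def e₁ : QAlg N β := (1 / 2 : ℂ) • (1 - K N β ^ 2)

/-- `ω_± = (e₀ ± i e₁) K`. -/
noncomputable def ω (s : Bool) : QAlg N β :=
  (e₀ N β + (sgn s * Complex.I) • e₁ N β) * K N β

end

/-- The generator `fᵢ^±`. -/
noncomputable def f {N : ℕ} {β : ℂ} (s : Bool) (i : Fin N) : QAlg N β := gen (QGen.f s i)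

section

variable {N : ℕ} {β : ℂ}

theorem f_mul_K (s : Bool) (i : Fin N) : f s i * K N β + K N β * f s i = 0 := by
  have h := RingQuot.mkAlgHom_rel ℂ (QRel.fK s i)
  simp only [map_add, map_mul, map_zero] at h
  exact h

theorem f_mul_f_pm (i j : Fin N) :
    f true i * f false j + f false j * f true i = if i = j then e₁ N β else 0 := by
  have h := RingQuot.mkAlgHom_rel ℂ (QRel.pm i j)
  rw [apply_ite (RingQuot.mkAlgHom ℂ (QRel N))] at h
  simp only [map_add, map_mul, map_zero, map_smul, map_sub, map_pow, map_one] at h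
  exact h

theorem f_mul_f (s : Bool) (i j : Fin N) :
    (f s i * f s j + f s j * f s i : QAlg N β) = 0 := by
  have h := RingQuot.mkAlgHom_rel ℂ (QRel.ff s i j)
  simp only [map_add, map_mul, map_zero] at h
  exact h

theorem K_pow_four : K N β ^ 4 = 1 := by
  have h := RingQuot.mkAlgHom_rel ℂ (QRel.K4 (N := N))
  simp only [map_pow, map_one] at h
  exact h

theorem K_mul_f (s : Bool) (i : Fin N) : K N β * f s i = -(f s i * K N β) :=
  eq_neg_of_add_eq_zero_right (f_mul_K s i)

theorem f_mul_f_swap (s : Bool) (i j : Fin N) :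
    (f s j * f s i : QAlg N β) = -(f s i * f s j) :=
  eq_neg_of_add_eq_zero_right (f_mul_f s i j)

theorem f_mul_f_mp (i j : Fin N) :
    (f false j * f true i : QAlg N β)
      = (if i = j then e₁ N β else 0) - f true i * f false j :=
  eq_sub_of_add_eq' (f_mul_f_pm i j)

theorem K_sq_mul_f (s : Bool) (i : Fin N) : K N β ^ 2 * f s i = f s i * K N β ^ 2 := by
  rw [pow_two, mul_assoc, K_mul_f, mul_neg, ← mul_assoc, K_mul_f, neg_mul, neg_neg, mul_assoc]

theorem e₀_add_e₁ : e₀ N β + e₁ N β = 1 := by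
  simp only [e₀, e₁]
  module

theorem e₁_mul_e₁ : e₁ N β * e₁ N β = e₁ N β := by
  have h : K N β ^ 2 * K N β ^ 2 = 1 := by rw [← pow_add, K_pow_four]
  simp only [e₁, smul_mul_smul_comm, mul_sub, sub_mul, mul_one, one_mul, h]
  module

theorem e₀_eq : e₀ N β = 1 - e₁ N β := eq_sub_of_add_eq e₀_add_e₁

theorem K_sq_eq : K N β ^ 2 = 1 - (2 : ℂ) • e₁ N β := by
  simp only [e₁]
  module

theorem e₁_mul_f (s : Bool) (i : Fin N) : e₁ N β * f s i = f s i * e₁ N β := by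
  simp [e₁, sub_mul, mul_sub, K_sq_mul_f]

theorem K_mul_e₁ : K N β * e₁ N β = e₁ N β * K N β := by
  simp only [e₁, mul_smul_comm, smul_mul_assoc, mul_sub, sub_mul, mul_one, one_mul]
  rw [← pow_succ, ← pow_succ']

/-- Products of elements `(e₀ + a e₁) K`. -/
theorem odd_mul_odd (a b : ℂ) :
    ((e₀ N β + a • e₁ N β) * K N β) * ((e₀ N β + b • e₁ N β) * K N β)
      = (e₀ N β + (a * b) • e₁ N β) * K N β ^ 2 := by
  have h : K N β * (e₀ N β + b • e₁ N β) = (e₀ N β + b • e₁ N β) * K N β := by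
    simp [e₀_eq, mul_add, add_mul, mul_sub, sub_mul, K_mul_e₁]
  rw [mul_assoc, ← mul_assoc (K N β), h, mul_assoc, ← pow_two, ← mul_assoc]
  congr 1
  simp only [e₀_eq, mul_add, add_mul, mul_sub, sub_mul, mul_one, one_mul, e₁_mul_e₁,
    mul_smul_comm, smul_mul_assoc]
  module

theorem odd_mul_f (a : ℂ) (s : Bool) (i : Fin N) :
    ((e₀ N β + a • e₁ N β) * K N β) * f s i
      = -(f s i * ((e₀ N β + a • e₁ N β) * K N β)) := by
  have h : (e₀ N β + a • e₁ N β) * f s i = f s i * (e₀ N β + a • e₁ N β) := by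
    simp [e₀_eq, mul_add, add_mul, mul_sub, sub_mul, e₁_mul_f]
  rw [mul_assoc, K_mul_f, mul_neg, ← mul_assoc, h, mul_assoc]

theorem odd_mul_odd_of_sq {a b : ℂ} (h : a * b = 1) :
    ((e₀ N β + a • e₁ N β) * K N β) * ((e₀ N β + b • e₁ N β) * K N β) = K N β ^ 2 := by
  rw [odd_mul_odd, h, one_smul, e₀_add_e₁, one_mul]

theorem odd_comm (a b : ℂ) :
    ((e₀ N β + a • e₁ N β) * K N β) * ((e₀ N β + b • e₁ N β) * K N β)
      = ((e₀ N β + b • e₁ N β) * K N β) * ((e₀ N β + a • e₁ N β) * K N β) := by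
  rw [odd_mul_odd, odd_mul_odd, mul_comm a b]

theorem odd_mul_K (a : ℂ) :
    ((e₀ N β + a • e₁ N β) * K N β) * K N β
      = K N β * ((e₀ N β + a • e₁ N β) * K N β) := by
  have h := odd_comm (N := N) (β := β) a 1
  rwa [one_smul, e₀_add_e₁, one_mul] at h

/-- A map on generators. -/
def genMap {A : Type*} (K' : A) (F : Bool → Fin N → A) : QGen N → A
  | QGen.K => K'
  | QGen.f s i => F s i

section

variable {A : Type*} [Ring A] [Algebra ℂ A] (K' : A) (F : Bool → Fin N → A)
    (hfK : ∀ s i, F s i * K' + K' * F s i = 0)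
    (hpm : ∀ i j, F true i * F false j + F false j * F true i
      = if i = j then (1 / 2 : ℂ) • (1 - K' ^ 2) else 0)
    (hff : ∀ s i j, F s i * F s j + F s j * F s i = 0)
    (hK : K' ^ 4 = 1)

theorem genMap_rel (hfK : ∀ s i, F s i * K' + K' * F s i = 0)
    (hpm : ∀ i j, F true i * F false j + F false j * F true i
      = if i = j then (1 / 2 : ℂ) • (1 - K' ^ 2) else 0)
    (hff : ∀ s i j, F s i * F s j + F s j * F s i = 0)
    (hK : K' ^ 4 = 1) ⦃x y : FreeAlgebra ℂ (QGen N)⦄ (h : QRel N x y) :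
    FreeAlgebra.lift ℂ (genMap K' F) x = FreeAlgebra.lift ℂ (genMap K' F) y := by
  cases h with
  | fK s i => simpa [genMap] using hfK s i
  | pm i j =>
    rw [apply_ite (FreeAlgebra.lift ℂ (genMap K' F))]
    simpa [genMap] using hpm i j
  | ff s i j => simpa [genMap] using hff s i j
  | K4 => simpa [genMap] using hK

variable (β) in
/-- The universal property of `Q(N, β)`. -/
noncomputable def lift : QAlg N β →ₐ[ℂ] A :=
  RingQuot.liftAlgHom ℂ ⟨FreeAlgebra.lift ℂ (genMap K' F), genMap_rel K' F hfK hpm hff hK⟩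

theorem lift_gen (g : QGen N) : lift β K' F hfK hpm hff hK (gen g) = genMap K' F g :=
  (RingQuot.liftAlgHom_mkAlgHom_apply ℂ _ (genMap_rel K' F hfK hpm hff hK) _).trans
    (FreeAlgebra.lift_ι_apply _ _)

@[simp] theorem lift_K : lift β K' F hfK hpm hff hK (K N β) = K' := lift_gen ..

@[simp] theorem lift_f (s : Bool) (i : Fin N) :
    lift β K' F hfK hpm hff hK (f s i) = F s i := lift_gen ..

end

theorem ω_mul_f (s t : Bool) (i : Fin N) : ω N β s * f t i = -(f t i * ω N β s) :=
  odd_mul_f ..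

theorem ω_mul_ω : ω N β true * ω N β false = K N β ^ 2 :=
  odd_mul_odd_of_sq (by simp [sgn])

theorem ω_mul_ω' : ω N β false * ω N β true = K N β ^ 2 :=
  odd_mul_odd_of_sq (by simp [sgn])

end

section

variable (N : ℕ) (β : ℂ)

/-- The coproduct of `K`: `K ⊗ K - (1 + (-1)^N) (e₁ ⊗ e₁)(K ⊗ K)`. -/
noncomputable def comulK : QAlg N β ⊗[ℂ] QAlg N β :=
  K N β ⊗ₜ K N β - (1 + (-1) ^ N : ℂ) • ((e₁ N β ⊗ₜ e₁ N β) * (K N β ⊗ₜ K N β))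

/-- The coproduct of `fᵢ^±`: `fᵢ^± ⊗ 1 + ω_± ⊗ fᵢ^±`. -/
noncomputable def comulF (s : Bool) (i : Fin N) : QAlg N β ⊗[ℂ] QAlg N β :=
  f s i ⊗ₜ 1 + ω N β s ⊗ₜ f s i

theorem comulK_sq : comulK N β ^ 2 = (K N β ^ 2) ⊗ₜ (K N β ^ 2) := by
  have h1 : K N β * (e₁ N β * K N β) = e₁ N β * K N β ^ 2 := by
    rw [← mul_assoc, K_mul_e₁, mul_assoc, pow_two]
  have h2 : (e₁ N β * K N β) * K N β = e₁ N β * K N β ^ 2 := by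
    rw [mul_assoc, pow_two]
  have h3 : (e₁ N β * K N β) * (e₁ N β * K N β) = e₁ N β * K N β ^ 2 := by
    rw [mul_assoc, h1, ← mul_assoc, e₁_mul_e₁]
  rcases neg_one_pow_eq_or ℂ N with h | h <;>
  · simp only [comulK, pow_two (_ - _), sub_mul, mul_sub, smul_mul_assoc, mul_smul_comm,
      Algebra.TensorProduct.tmul_mul_tmul, h1, h2, h3, ← pow_two (K N β), h]
    module

/-- The coproduct of `Q(N, β)`, an algebra map. -/
noncomputable def comulHom : QAlg N β →ₐ[ℂ] QAlg N β ⊗[ℂ] QAlg N β :=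
  lift β (comulK N β) (comulF N β)
    (by
      intro s i
      have h1 : e₁ N β * K N β * f s i = -(f s i * (e₁ N β * K N β)) := by
        rw [mul_assoc, K_mul_f, mul_neg, ← mul_assoc, e₁_mul_f, mul_assoc]
      have h2 : ω N β s * (e₁ N β * K N β) = e₁ N β * K N β * ω N β s := by
        have h : ω N β s * e₁ N β = e₁ N β * ω N β s := by
          simp only [ω, e₀_eq, add_mul, sub_mul, mul_add, mul_sub, mul_assoc, K_mul_e₁,
            smul_mul_assoc, mul_smul_comm, one_mul]
        rw [← mul_assoc, h, mul_assoc, mul_assoc]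
        exact congrArg _ (odd_mul_K _)
      have h3 : ω N β s * K N β = K N β * ω N β s := odd_mul_K _
      simp only [comulK, comulF, add_mul, mul_add, sub_mul, mul_sub, smul_mul_assoc,
        mul_smul_comm, Algebra.TensorProduct.tmul_mul_tmul, one_mul, mul_one, K_mul_f, h1, h2,
        h3, TensorProduct.neg_tmul, TensorProduct.tmul_neg]
      module)
    (by
      intro i j
      rw [comulK_sq]
      simp only [comulF, add_mul, mul_add, Algebra.TensorProduct.tmul_mul_tmul, one_mul, mul_one,
        ω_mul_f, ω_mul_ω, ω_mul_ω', f_mul_f_mp, TensorProduct.neg_tmul,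
        TensorProduct.sub_tmul, TensorProduct.tmul_sub]
      split_ifs
      · simp only [e₁, Algebra.TensorProduct.one_def, TensorProduct.tmul_smul,
          TensorProduct.tmul_sub]
        simp only [← TensorProduct.smul_tmul', TensorProduct.sub_tmul]
        module
      · simp only [TensorProduct.zero_tmul, TensorProduct.tmul_zero]
        module)
    (by
      intro s i j
      simp only [comulF, add_mul, mul_add, Algebra.TensorProduct.tmul_mul_tmul, one_mul, mul_one,
        ω_mul_f, f_mul_f_swap s i j, TensorProduct.neg_tmul, TensorProduct.tmul_neg]
      abel)
    (by
      rw [show (4 : ℕ) = 2 + 2 from rfl, pow_add, comulK_sq,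
        Algebra.TensorProduct.tmul_mul_tmul, ← pow_add, K_pow_four]
      rfl)

/-- The counit of `Q(N, β)`: `ε(K) = 1`, `ε(fᵢ^±) = 0`. -/
noncomputable def counitHom : QAlg N β →ₐ[ℂ] ℂ :=
  lift β 1 (fun _ _ => 0) (by simp) (by simp) (by simp) (by simp)

/-- The antipode of `K`: `(e₀ + (-1)^N e₁) K`. -/
noncomputable def antipodeK : QAlg N β :=
  (e₀ N β + ((-1) ^ N : ℂ) • e₁ N β) * K N β

/-- The antipode of `fᵢ^±`: `fᵢ^± (e₀ ± (-1)^N i e₁) K`. -/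
noncomputable def antipodeF (s : Bool) (i : Fin N) : QAlg N β :=
  f s i * ((e₀ N β + (sgn s * (-1) ^ N * Complex.I) • e₁ N β) * K N β)

theorem antipodeK_sq : antipodeK N β ^ 2 = K N β ^ 2 := by
  rw [pow_two, antipodeK, odd_mul_odd_of_sq]
  rw [← pow_add, ← two_mul, pow_mul]
  norm_num

/-- The antipode of `Q(N, β)`, as an algebra map to the opposite algebra. -/
noncomputable def antipodeHom : QAlg N β →ₐ[ℂ] (QAlg N β)ᵐᵒᵖ :=
  lift β (MulOpposite.op (antipodeK N β)) (fun s i => MulOpposite.op (antipodeF N β s i))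
    (by
      intro s i
      rw [← MulOpposite.op_mul, ← MulOpposite.op_mul, ← MulOpposite.op_add]
      refine congrArg MulOpposite.op ?_
      rw [antipodeK, antipodeF, ← mul_assoc, odd_mul_f, neg_mul, mul_assoc (f s i),
        mul_assoc (f s i), odd_comm, neg_add_cancel])
    (by
      intro i j
      rw [← MulOpposite.op_mul, ← MulOpposite.op_mul, ← MulOpposite.op_add,
        ← MulOpposite.op_pow, antipodeK_sq, ← MulOpposite.op_one, ← MulOpposite.op_sub,
        ← MulOpposite.op_smul, ← MulOpposite.op_zero, ← apply_ite MulOpposite.op]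
      refine congrArg MulOpposite.op ?_
      have h : ∀ s t : Bool, sgn s * sgn t = -1 → ∀ a b : Fin N,
          antipodeF N β s a * antipodeF N β t b = -(f s a * f t b * K N β ^ 2) := by
        intro s t hst a b
        rw [antipodeF, antipodeF, mul_assoc, ← mul_assoc _ (f t b), odd_mul_f, neg_mul, mul_assoc,
          odd_mul_odd_of_sq, mul_neg, mul_assoc]
        have hN : ((-1 : ℂ) ^ N) * (-1) ^ N = 1 := by
          rw [← pow_add, ← two_mul, pow_mul]
          norm_num
        calc sgn s * (-1) ^ N * Complex.I * (sgn t * (-1) ^ N * Complex.I)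
            = (sgn s * sgn t) * (((-1 : ℂ) ^ N) * (-1) ^ N) * (Complex.I * Complex.I) := by ring
          _ = 1 := by rw [hst, hN, Complex.I_mul_I]; norm_num
      rw [h _ _ (by simp [sgn]), h _ _ (by simp [sgn]), ← neg_add, ← add_mul, add_comm, f_mul_f_pm]
      split_ifs
      · rw [K_sq_eq, mul_sub, mul_one, mul_smul_comm, e₁_mul_e₁]
        module
      · simp)
    (by
      intro s i j
      rw [← MulOpposite.op_mul, ← MulOpposite.op_mul, ← MulOpposite.op_add]
      refine congrArg MulOpposite.op ?_
      have h : ∀ a b : Fin N, antipodeF N β s a * antipodeF N β s b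
          = -(f s a * f s b
            * (((e₀ N β + (sgn s * (-1) ^ N * Complex.I) • e₁ N β) * K N β)
              * ((e₀ N β + (sgn s * (-1) ^ N * Complex.I) • e₁ N β) * K N β))) := by
        intro a b
        rw [antipodeF, antipodeF, mul_assoc, ← mul_assoc _ (f s b), odd_mul_f, neg_mul, mul_assoc,
          mul_neg, ← mul_assoc]
      rw [h, h, f_mul_f_swap s i j]
      simp)
    (by
      rw [← MulOpposite.op_pow, show (4 : ℕ) = 2 * 2 from rfl, pow_mul, antipodeK_sq, ← pow_mul,
        K_pow_four]
      rfl)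

/-- The Hopf algebra operations of `Q(N, β)`. -/
noncomputable def hopfData : HopfData ℂ (QAlg N β) where
  mul := LinearMap.mul ℂ (QAlg N β)
  one := 1
  comul := (comulHom N β).toLinearMap
  counit := (counitHom N β).toLinearMap
  antipode := (MulOpposite.opLinearEquiv ℂ).symm.toLinearMap ∘ₗ (antipodeHom N β).toLinearMap

/-- The coassociator
`Φ = 1 ⊗ 1 ⊗ 1 + e₁ ⊗ e₁ ⊗ {(K^N - 1) e₀ + (β² (iK)^N - 1) e₁}` of `Q(N, β)`. -/
noncomputable def coassociator : QAlg N β ⊗[ℂ] (QAlg N β ⊗[ℂ] QAlg N β) :=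
  1 ⊗ₜ (1 ⊗ₜ 1) + e₁ N β ⊗ₜ (e₁ N β ⊗ₜ
    ((K N β ^ N - 1) * e₀ N β + (β ^ 2 • (Complex.I • K N β) ^ N - 1) * e₁ N β))

/-- The evaluation element `α = 1` of the quasi-Hopf algebra `Q(N, β)`. -/
noncomputable def evalElement : QAlg N β := 1

/-- The coevaluation element `e₀ + β² (iK)^N e₁` of the quasi-Hopf algebra `Q(N, β)`. -/
noncomputable def coevalElement : QAlg N β :=
  e₀ N β + β ^ 2 • ((Complex.I • K N β) ^ N * e₁ N β)

/-- The pair of idempotents `e₀, e₁`. -/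
noncomputable def idem : Fin 2 → QAlg N β := ![e₀ N β, e₁ N β]

/-- The Cartan factor `ρ_{n,m} = ½ ∑_{i,j ∈ {0,1}} (-1)^{ij} i^{-in+jm} K^i ⊗ K^j`. -/
noncomputable def cartan (n m : Fin 2) : QAlg N β ⊗[ℂ] QAlg N β :=
  (1 / 2 : ℂ) • ∑ i : Fin 2, ∑ j : Fin 2,
    ((-1 : ℂ) ^ ((i : ℕ) * (j : ℕ))
        * Complex.I ^ (-((i : ℕ) : ℤ) * ((n : ℕ) : ℤ) + ((j : ℕ) : ℤ) * ((m : ℕ) : ℤ))) •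
      ((K N β ^ (i : ℕ)) ⊗ₜ[ℂ] (K N β ^ (j : ℕ)))

/-- The universal R-matrix of `Q(N, β)`:
`(∑_{n,m} β^{nm} ρ_{n,m} (eₙ ⊗ eₘ)) ∏ₖ (1 ⊗ 1 - 2 fₖ⁻ ω₋ ⊗ fₖ⁺)`. -/
noncomputable def rMatrix : QAlg N β ⊗[ℂ] QAlg N β :=
  (∑ n : Fin 2, ∑ m : Fin 2, β ^ ((n : ℕ) * (m : ℕ)) •
      (cartan N β n m * (idem N β n ⊗ₜ[ℂ] idem N β m))) *
    ((List.finRange N).map fun i : Fin N =>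
      (1 ⊗ₜ 1 - (2 : ℂ) • ((f false i * ω N β false) ⊗ₜ f true i) :
        QAlg N β ⊗[ℂ] QAlg N β)).prod

end

end QAlg

/-! ## Ordered products of commuting factors -/

/-! Write H = H(N) and Q = Q(N,β). Everything is encoded in one element R' of H ⊗ Q, `HAlg.mixedR`,
the candidate for the R-matrix of the double with its first leg left in H. There is an algebra map v
: H → Q with v(k) = ω₋ and v(fᵢ) = fᵢ⁻ω₋ (`HAlg.toQ`). Contracting the first leg of R' gives a
linear map u : H* → Q (`HAlg.dualToQ`). The isomorphism is Ψ(φ ⊗ a) = u(φ)v(a).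

Multiplicativity of Ψ amounts to two identities for R'. The equation (Δ ⊗ id)(R') = R'₁₃R'₂₃
(`HAlg.mixedR_comul`) says that u is multiplicative. The intertwining relation R'·(id ⊗ v)Δ(a) = (id
⊗ v)Δᵒᵖ(a)·R' (`HAlg.mixedR_intertwine`), multiplied by S⁻¹ of a third coproduct leg, becomes
exactly the straightening rule v(a)u(ψ) = ∑ u(ψ(S⁻¹(a''')(-)a')) v(a'') of the double.

Bijectivity uses no explicit basis of H or Q. The range of Ψ is closed under products and contains
generators of Q, so Ψ is onto and Q is finite-dimensional. Ordered monomials give dim H ≤ 2·2^N.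
Four Clifford modules, one for each fourth root of unity l by which K acts on the unit vector, give
dim Q ≥ 4·2^(2N). Hence dim D(H) ≤ (2·2^N)² ≤ dim Q, and the surjection is injective.

For even N the elements ω₊ and ω₋ are group-like, so Q is generated by group-likes and
skew-primitives and its Hopf axioms can be checked on generators. Three further identities for R'
make u compatible with coproduct, counit and antipode: (id ⊗ Δ)(R') = R'₁₃R'₁₂, (id ⊗ ε)(R') = 1 and
(S⁻¹ ⊗ id)(R') = (id ⊗ S)(R'). For β = 1 both R and (Ψ ⊗ Ψ)(R_D) equal (v ⊗ id)(R'), and the hexagon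
identities for R are images of the identities for R'. No axiom is verified in the double itself:
associativity, the Hopf axioms and quasi-triangularity are all pulled back from Q along Ψ. -/

theorem List.prod_map_mul_of_commute {ι M : Type*} [Monoid M] (l : List ι) (A B : ι → M)
    (h : ∀ i j, Commute (B i) (A j)) :
    (l.map fun i => A i * B i).prod = (l.map A).prod * (l.map B).prod := by
  induction l with
  | nil => simp
  | cons i t ih =>
    have hc : Commute (B i) (t.map A).prod :=
      Commute.list_prod_right _ _ fun x hx => by
        obtain ⟨j, -, rfl⟩ := List.mem_map.mp hx
        exact h i j
    simp only [List.map_cons, List.prod_cons, ih]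
    rw [mul_assoc, ← mul_assoc (B i), hc.eq]
    simp only [mul_assoc]

theorem List.prod_map_conj {ι M : Type*} [Monoid M] (l : List ι) (A B : ι → M) (c : M)
    (h : ∀ i, A i * c = c * B i) : (l.map A).prod * c = c * (l.map B).prod := by
  induction l with
  | nil => simp
  | cons i t ih =>
    simp only [List.map_cons, List.prod_cons]
    rw [mul_assoc, ih, ← mul_assoc, h, mul_assoc]

/-- Factors to the right of the i-th let `a` pass, the i-th turns `a` into `b`, and those to its
left let `b` pass. `Nodup` guarantees that the conversion happens only once. -/
theorem List.prod_map_intertwine {ι M : Type*} [Monoid M] {l : List ι} (hl : l.Nodup)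
    (X : ι → M) (a b : M) {i : ι} (hi : i ∈ l) (h : X i * a = b * X i)
    (ha : ∀ j, j ≠ i → Commute (X j) a) (hb : ∀ j, j ≠ i → Commute (X j) b) :
    (l.map X).prod * a = b * (l.map X).prod := by
  induction l with
  | nil => simp at hi
  | cons j t ih =>
    rw [List.nodup_cons] at hl
    simp only [List.map_cons, List.prod_cons]
    by_cases hj : j = i
    · subst hj
      have hc : Commute (t.map X).prod a :=
        Commute.list_prod_left _ _ fun x hx => by
          obtain ⟨m, hm, rfl⟩ := List.mem_map.mp hx
          exact ha m fun hmj => hl.1 (hmj ▸ hm)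
      rw [mul_assoc, hc.eq, ← mul_assoc, h, mul_assoc]
    · have hit : i ∈ t := by simpa [Ne.symm hj] using hi
      rw [mul_assoc, ih hl.2 hit, ← mul_assoc, (hb j hj).eq, mul_assoc]

/-! ## Further identities in `Q(N, β)` -/

namespace QAlg

section

variable {N : ℕ} {β : ℂ}

theorem f_mul_f_self (s : Bool) (i : Fin N) : (f s i * f s i : QAlg N β) = 0 := by
  have h := f_mul_f (β := β) s i i
  rw [← two_smul ℂ] at h
  exact (smul_eq_zero.mp h).resolve_left two_ne_zero

theorem K_sq_mul_K_sq : K N β ^ 2 * K N β ^ 2 = 1 := by rw [← pow_add, K_pow_four]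

theorem K_sq_eq_sub : K N β ^ 2 = e₀ N β - e₁ N β := by
  simp only [e₀, e₁]
  module

/-- Since (±i)² = -1, the square is (e₀ - e₁)K² = K⁴ = 1. -/
theorem ω_mul_self (s : Bool) : ω N β s * ω N β s = 1 := by
  rw [ω, odd_mul_odd, show sgn s * Complex.I * (sgn s * Complex.I) = -1 by
    cases s <;> simp [sgn], neg_one_smul, ← sub_eq_add_neg, ← K_sq_eq_sub, K_sq_mul_K_sq]

theorem ω_comm (s t : Bool) : ω N β s * ω N β t = ω N β t * ω N β s := odd_comm ..

theorem K_sq_mul_ω : K N β ^ 2 * ω N β false = ω N β true := by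
  rw [← ω_mul_ω, mul_assoc, ω_mul_self, mul_one]

theorem K_sq_eq_ω_mul_ω : K N β ^ 2 = ω N β true * ω N β false := ω_mul_ω.symm

/-- The inverse of e₀ + i e₁ is e₀ - i e₁, which is a polynomial in K² = ω₊ω₋. So the ω's recover K
and can replace it as generators. -/
theorem K_eq : K N β = (e₀ N β - Complex.I • e₁ N β) * ω N β true := by
  have h : (e₀ N β - Complex.I • e₁ N β) * (e₀ N β + (sgn true * Complex.I) • e₁ N β) = 1 := by
    simp only [e₀_eq, sgn, one_mul, mul_add, sub_mul, mul_sub, mul_one, smul_mul_assoc,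
      mul_smul_comm, e₁_mul_e₁]
    linear_combination (norm := module) (-Complex.I_sq) • (e₁ N β)
  rw [ω, ← mul_assoc, h, one_mul]

/-- Induction along products of generators. -/
theorem induction {P : QAlg N β → Prop} (hc : ∀ c : ℂ, P (algebraMap ℂ _ c)) (hK : P (K N β))
    (hf : ∀ s i, P (f s i)) (hmul : ∀ a b, P a → P b → P (a * b))
    (hadd : ∀ a b, P a → P b → P (a + b)) (a : QAlg N β) : P a := by
  obtain ⟨x, rfl⟩ : ∃ x, (RingQuot.mkAlgHom ℂ (QRel N) x : QAlg N β) = a :=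
    RingQuot.mkAlgHom_surjective ℂ (QRel N) a
  induction x using FreeAlgebra.induction with
  | grade0 r => rw [AlgHom.commutes]; exact hc r
  | grade1 g =>
    cases g with
    | K => exact hK
    | f s i => exact hf s i
  | mul a b ha hb => rw [map_mul]; exact hmul _ _ ha hb
  | add a b ha hb => rw [map_add]; exact hadd _ _ ha hb

/-- `Q(N, β)` is generated by `ω_±` and `fᵢ^±`. -/
theorem induction_ω {P : QAlg N β → Prop} (hc : ∀ c : ℂ, P (algebraMap ℂ _ c))
    (hω : ∀ s, P (ω N β s))
    (hf : ∀ s i, P (f s i)) (hmul : ∀ a b, P a → P b → P (a * b))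
    (hadd : ∀ a b, P a → P b → P (a + b)) (a : QAlg N β) : P a := by
  have hs : ∀ (c : ℂ) a, P a → P (c • a) := fun c a ha => by
    rw [Algebra.smul_def]; exact hmul _ _ (hc c) ha
  refine induction hc ?_ hf hmul hadd a
  have h1 : P 1 := by simpa using hc 1
  have he : P (K N β ^ 2) := by
    rw [K_sq_eq_ω_mul_ω]; exact hmul _ _ (hω _) (hω _)
  rw [K_eq, show e₀ N β - Complex.I • e₁ N β
    = ((1 - Complex.I) / 2) • 1 + ((1 + Complex.I) / 2) • K N β ^ 2 by
      simp only [e₀, e₁]; module]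
  exact hmul _ _ (hadd _ _ (hs _ _ h1) (hs _ _ he)) (hω _)

theorem algHom_ext_ω {A : Type*} [Ring A] [Algebra ℂ A] {φ ψ : QAlg N β →ₐ[ℂ] A}
    (hω : ∀ s, φ (ω N β s) = ψ (ω N β s)) (hf : ∀ s i, φ (f s i) = ψ (f s i)) : φ = ψ := by
  ext a
  induction a using induction_ω with
  | hc c => simp
  | hω s => exact hω s
  | hf s i => exact hf s i
  | hmul a b ha hb => simp [ha, hb]
  | hadd a b ha hb => simp [ha, hb]

end

end QAlg

/-! ## The matrix `R' ∈ H(N) ⊗ Q(N, β)` and the maps `v`, `u` it defines -/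

namespace HAlg

section

variable (N : ℕ) (β : ℂ)

/-- The algebra map `H(N) → Q(N, β)`, `k ↦ ω₋`, `fᵢ ↦ fᵢ⁻ ω₋`. -/
noncomputable def toQ : HAlg N →ₐ[ℂ] QAlg N β :=
  lift (QAlg.ω N β false) (fun i => QAlg.f false i * QAlg.ω N β false)
    (fun i j => by
      have h : ∀ a b : Fin N, QAlg.f false a * QAlg.ω N β false * (QAlg.f false b * QAlg.ω N β false)
          = -(QAlg.f false a * QAlg.f false b) := fun a b => by
        rw [mul_assoc, ← mul_assoc (QAlg.ω N β false), QAlg.ω_mul_f, neg_mul, mul_assoc,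
          QAlg.ω_mul_self, mul_one, mul_neg]
      rw [h, h, ← neg_add, QAlg.f_mul_f, neg_zero])
    (fun i => by
      rw [← mul_assoc, QAlg.ω_mul_f, neg_mul, mul_assoc, add_neg_cancel])
    (QAlg.ω_mul_self _)

@[simp] theorem toQ_k : toQ N β (k N) = QAlg.ω N β false := by simp [toQ]

@[simp] theorem toQ_f (i : Fin N) : toQ N β (f i) = QAlg.f false i * QAlg.ω N β false := by
  simp [toQ]

/-- The Cartan part `½(1 + k) ⊗ 1 + ½(1 - k) ⊗ ω₊`. -/
noncomputable def mixedCartan : HAlg N ⊗[ℂ] QAlg N β :=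
  (1 / 2 : ℂ) • ((1 + k N) ⊗ₜ 1 + (1 - k N) ⊗ₜ QAlg.ω N β true)

variable {N} in
/-- The factor `1 ⊗ 1 - 2 fᵢ ⊗ fᵢ⁺`. -/
noncomputable def mixedFactor (i : Fin N) : HAlg N ⊗[ℂ] QAlg N β :=
  1 ⊗ₜ 1 - (2 : ℂ) • (f i ⊗ₜ QAlg.f true i)

/-- The R-matrix with first leg in `H(N)` and second leg in `Q(N, β)`. -/
noncomputable def mixedR : HAlg N ⊗[ℂ] QAlg N β :=
  mixedCartan N β * ((List.finRange N).map (mixedFactor β)).prod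

theorem mixedR_mul_k :
    mixedR N β * (k N ⊗ₜ QAlg.ω N β false) = (k N ⊗ₜ QAlg.ω N β false) * mixedR N β := by
  rw [mixedR, mul_assoc, List.prod_map_conj _ _ (mixedFactor β), ← mul_assoc, ← mul_assoc]
  · congr 1
    simp only [mixedCartan, mul_smul_comm, smul_mul_assoc, add_mul, mul_add, sub_mul, mul_sub,
      Algebra.TensorProduct.tmul_mul_tmul, one_mul, mul_one, QAlg.ω_comm true false]
  · intro i
    simp only [mixedFactor, mul_smul_comm, smul_mul_assoc, sub_mul, mul_sub,
      Algebra.TensorProduct.tmul_mul_tmul, one_mul, mul_one, QAlg.ω_mul_f, k_mul_f,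
      TensorProduct.neg_tmul, TensorProduct.tmul_neg, neg_neg]

theorem mixedR_mul_f (i : Fin N) :
    mixedR N β * (f i ⊗ₜ QAlg.ω N β false + 1 ⊗ₜ (QAlg.f false i * QAlg.ω N β false))
      = (k N ⊗ₜ (QAlg.f false i * QAlg.ω N β false) + f i ⊗ₜ 1) * mixedR N β := by
  -- Throughout, products are reordered by moving fᵢ⁻ω₋ as a unit. It anticommutes with ω₊, and
  -- moving fⱼ⁺ past it leaves e₁ω₋ exactly when j = i.
  have hωf : QAlg.ω N β true * (QAlg.f false i * QAlg.ω N β false)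
      = -(QAlg.f false i * QAlg.ω N β false * QAlg.ω N β true) := by
    rw [← mul_assoc, QAlg.ω_mul_f, neg_mul, mul_assoc, QAlg.ω_comm, mul_assoc]
  have hff : ∀ j, QAlg.f true j * (QAlg.f false i * QAlg.ω N β false)
      = (if j = i then QAlg.e₁ N β * QAlg.ω N β false else 0)
        + QAlg.f false i * QAlg.ω N β false * QAlg.f true j := by
    intro j
    rw [mul_assoc (QAlg.f false i), QAlg.ω_mul_f, mul_neg, ← mul_assoc, ← mul_assoc, ← sub_eq_add_neg,
      eq_sub_iff_add_eq, ← add_mul, QAlg.f_mul_f_pm, ite_mul, zero_mul]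
  have hcomm : ∀ j, j ≠ i → ∀ s, Commute (mixedFactor β j)
      (f i ⊗ₜ QAlg.ω N β s + 1 ⊗ₜ (QAlg.f false i * QAlg.ω N β false)) := by
    intro j hj s
    simp only [Commute, SemiconjBy, mixedFactor, mul_smul_comm, smul_mul_assoc, add_mul, mul_add,
      sub_mul, mul_sub, Algebra.TensorProduct.tmul_mul_tmul, one_mul, mul_one, QAlg.ω_mul_f,
      f_mul_f_swap j i, hff, if_neg hj, zero_add, TensorProduct.neg_tmul, TensorProduct.tmul_neg,
      neg_neg]
    module
  -- The intermediate element has ω₊ in place of ω₋. In the i-th nilpotent factor, swapping fᵢ⁺ with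
  -- fᵢ⁻ω₋ produces -2e₁ω₋, and ω₋ - 2e₁ω₋ = K²ω₋ = ω₊. The Cartan part then carries this element to
  -- the opposite coproduct.
  rw [mixedR, mul_assoc, List.prod_map_intertwine (List.nodup_finRange N) _ _
    (f i ⊗ₜ QAlg.ω N β true + 1 ⊗ₜ (QAlg.f false i * QAlg.ω N β false)) (List.mem_finRange i),
    ← mul_assoc, ← mul_assoc]
  · congr 1
    simp only [mixedCartan, mul_smul_comm, smul_mul_assoc, add_mul, mul_add, sub_mul, mul_sub,
      Algebra.TensorProduct.tmul_mul_tmul, one_mul, mul_one, QAlg.ω_mul_self, hωf,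
      k_mul_k, k_mul_f, TensorProduct.add_tmul, TensorProduct.sub_tmul,
      TensorProduct.neg_tmul, TensorProduct.tmul_neg]
    module
  · simp only [mixedFactor, mul_smul_comm, smul_mul_assoc, add_mul, mul_add,
      sub_mul, mul_sub, Algebra.TensorProduct.tmul_mul_tmul, one_mul, mul_one,
      f_mul_f_self, hff, if_true, TensorProduct.zero_tmul, smul_zero, sub_zero,
      TensorProduct.tmul_add, ← QAlg.K_sq_mul_ω, QAlg.K_sq_eq, smul_mul_assoc,
      TensorProduct.tmul_sub, TensorProduct.tmul_smul]
    module
  · exact fun j hj => hcomm j hj _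
  · exact fun j hj => hcomm j hj _

/-- `R' (id ⊗ v)Δ(a) = (id ⊗ v)Δᵒᵖ(a) R'`. -/
theorem mixedR_intertwine (a : HAlg N) :
    mixedR N β * Algebra.TensorProduct.map (AlgHom.id ℂ _) (toQ N β) (comulHom N a)
      = Algebra.TensorProduct.map (AlgHom.id ℂ _) (toQ N β)
          (Algebra.TensorProduct.comm ℂ _ _ (comulHom N a)) * mixedR N β := by
  induction a using induction with
  | hc c => simp [Algebra.algebraMap_eq_smul_one]
  | hk => simpa using mixedR_mul_k N β
  | hf i => simpa using mixedR_mul_f N β i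
  | hmul a b ha hb => simp only [map_mul]; rw [← mul_assoc, ha, mul_assoc, hb, mul_assoc]
  | hadd a b ha hb => simp only [map_add, mul_add, add_mul, ha, hb]

end

end HAlg

/-! ## Contracting a tensor with linear forms -/

section Contract

variable {k A B : Type*} [Field k] [Ring A] [Algebra k A] [Ring B] [Algebra k B]

/-- `contract (a ⊗ b) φ = φ(a) b`. -/
noncomputable def contract : A ⊗[k] B →ₗ[k] Module.Dual k A →ₗ[k] B :=
  TensorProduct.lift
    (LinearMap.mk₂ k (fun a b => (Module.Dual.eval k A a).smulRight b)
      (fun _ _ _ => by ext; simp [add_smul])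
      (fun _ _ _ => by ext; simp [mul_smul])
      (fun _ _ _ => by ext; simp)
      (fun c _ _ => by ext; simp [smul_comm c]))

@[simp] theorem contract_tmul (a : A) (b : B) (φ : Module.Dual k A) :
    contract (a ⊗ₜ[k] b) φ = φ a • b := by
  simp [contract]

theorem contract_rTensor {C : Type*} [Ring C] [Algebra k C] (F : A →ₗ[k] C) (T : A ⊗[k] B)
    (φ : Module.Dual k C) : contract (F.rTensor B T) φ = contract T (φ ∘ₗ F) := by
  induction T with
  | zero => simp
  | add S T hS hT => simp [hS, hT]
  | tmul a b => simp

theorem contract_lTensor {C : Type*} [Ring C] [Algebra k C] (F : B →ₗ[k] C) (T : A ⊗[k] B)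
    (φ : Module.Dual k A) : contract (F.lTensor A T) φ = F (contract T φ) := by
  induction T with
  | zero => simp
  | add S T hS hT => simp [hS, hT]
  | tmul a b => simp

/-- Evaluating φ ⊗ ψ on the first two legs of S₁₃T₂₃ decouples the factors. This turns the coproduct
formula for R' into multiplicativity of u. -/
theorem contract_legs {A' : Type*} [Ring A'] [Algebra k A'] (S : A ⊗[k] B) (T : A' ⊗[k] B)
    (φ : Module.Dual k A) (ψ : Module.Dual k A') :
    contract (Algebra.TensorProduct.map (Algebra.TensorProduct.includeLeft (R := k) (S := k))
        (AlgHom.id k B) S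
      * Algebra.TensorProduct.map Algebra.TensorProduct.includeRight (AlgHom.id k B) T)
      (TensorProduct.dualDistrib k A A' (φ ⊗ₜ ψ)) = contract S φ * contract T ψ := by
  induction S with
  | zero => simp
  | add S S' hS hS' => simp [add_mul, hS, hS']
  | tmul a b =>
    induction T with
    | zero => simp
    | add S S' hS hS' => simp only [mul_add, map_add, LinearMap.add_apply, hS, hS']
    | tmul a' b' => simp [smul_smul, mul_comm]

theorem contract_translate (c d : A) (T : A ⊗[k] B) (q : B) (ψ ψ' : Module.Dual k A)
    (h : ∀ x, ψ' x = ψ (c * (x * d))) :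
    contract ((c ⊗ₜ 1) * (T * (d ⊗ₜ q))) ψ = contract T ψ' * q := by
  induction T with
  | zero => simp
  | add S T hS hT => simp [add_mul, mul_add, hS, hT]
  | tmul a b => simp [h]

/-- Expanding the first leg in a basis, the coefficients in the second leg are the contractions with
the dual basis. This identifies the canonical R-matrix of the double with R'. -/
theorem sum_contract [FiniteDimensional k A] (T : A ⊗[k] B) :
    (contract T).lTensor A (coevaluation k A 1) = T := by
  rw [coevaluation_apply_one]
  induction T with
  | zero => simp
  | add S T hS hT =>
    rw [map_sum] at *
    simp only [LinearMap.lTensor_tmul] at *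
    simp only [map_add, LinearMap.add_apply, TensorProduct.tmul_add, Finset.sum_add_distrib,
      hS, hT]
  | tmul a b =>
    simp only [map_sum, LinearMap.lTensor_tmul, contract_tmul, ← TensorProduct.smul_tmul,
      ← TensorProduct.sum_tmul]
    congr 1
    conv_rhs => rw [← (Module.Basis.ofVectorSpace k A).sum_repr a]
    rfl

end Contract

/-! ### The coproduct of the first leg of R', and the algebra map u -/

namespace HAlg

section

variable (N : ℕ) (β : ℂ)

/-- With p± = ½(1 ± k), the Cartan part is p₊ ⊗ 1 + p₋ ⊗ ω₊. As ω₊² = 1, it is a bicharacter on two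
copies of ℤ/2. -/
theorem mixedCartan_comul :
    Algebra.TensorProduct.map (comulHom N) (AlgHom.id ℂ _) (mixedCartan N β)
      = Algebra.TensorProduct.map (Algebra.TensorProduct.includeLeft (R := ℂ) (S := ℂ))
          (AlgHom.id ℂ _) (mixedCartan N β)
        * Algebra.TensorProduct.map Algebra.TensorProduct.includeRight (AlgHom.id ℂ _)
          (mixedCartan N β) := by
  simp only [mixedCartan, map_smul, map_add, Algebra.TensorProduct.map_tmul, map_sub, map_one,
    comulHom_k, AlgHom.id_apply, Algebra.TensorProduct.includeLeft_apply,
    Algebra.TensorProduct.includeRight_apply, mul_add, add_mul, mul_smul_comm, smul_mul_assoc,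
    Algebra.TensorProduct.tmul_mul_tmul, mul_one, one_mul, QAlg.ω_mul_self,
    Algebra.TensorProduct.one_def, TensorProduct.add_tmul, TensorProduct.sub_tmul,
    mul_sub, sub_mul]
  module

theorem mixedR_comul :
    Algebra.TensorProduct.map (comulHom N) (AlgHom.id ℂ _) (mixedR N β)
      = Algebra.TensorProduct.map (Algebra.TensorProduct.includeLeft (R := ℂ) (S := ℂ))
          (AlgHom.id ℂ _) (mixedR N β)
        * Algebra.TensorProduct.map Algebra.TensorProduct.includeRight (AlgHom.id ℂ _)
          (mixedR N β) := by
  simp only [mixedR, map_mul, map_list_prod, List.map_map, mixedCartan_comul]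
  rw [mul_assoc, mul_assoc]
  congr 1
  -- The second Cartan part is moved left through the first nilpotent product. Because fᵢ⁺
  -- anticommutes with ω₊, this turns fᵢ ⊗ 1 ⊗ fᵢ⁺ into fᵢ ⊗ k ⊗ fᵢ⁺. The two products then merge
  -- factor by factor into 1 - 2Δ(fᵢ) ⊗ fᵢ⁺, the cross term vanishing because (fᵢ⁺)² = 0.
  rw [← mul_assoc (List.prod _), List.prod_map_conj (B := fun i : Fin N =>
    (1 - (2 : ℂ) • ((f i ⊗ₜ k N) ⊗ₜ QAlg.f true i) : (HAlg N ⊗[ℂ] HAlg N) ⊗[ℂ] QAlg N β)),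
    mul_assoc]
  · congr 1
    rw [← List.prod_map_mul_of_commute]
    · congr 1
      refine List.map_congr_left fun i _ => ?_
      simp only [Function.comp_apply, mixedFactor, map_sub, map_smul, map_one,
        Algebra.TensorProduct.map_tmul, comulHom_f, AlgHom.id_apply,
        Algebra.TensorProduct.includeRight_apply, mul_sub, sub_mul, mul_smul_comm, smul_mul_assoc,
        Algebra.TensorProduct.tmul_mul_tmul, QAlg.f_mul_f_self, TensorProduct.tmul_zero,
        ← Algebra.TensorProduct.one_def, one_mul, mul_one, TensorProduct.add_tmul]
      module
    · intro i j
      simp only [Commute, SemiconjBy, Function.comp_apply, mixedFactor, map_sub, map_smul, map_one,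
        Algebra.TensorProduct.map_tmul, AlgHom.id_apply, ← Algebra.TensorProduct.one_def,
        Algebra.TensorProduct.includeRight_apply, mul_sub, sub_mul, mul_smul_comm, smul_mul_assoc,
        Algebra.TensorProduct.tmul_mul_tmul, one_mul, mul_one, k_mul_f,
        QAlg.f_mul_f_swap true j i, TensorProduct.neg_tmul, TensorProduct.tmul_neg]
      module
  · intro i
    simp only [Function.comp_apply, mixedFactor, mixedCartan, map_sub, map_smul, map_add, map_one,
      Algebra.TensorProduct.map_tmul, AlgHom.id_apply, Algebra.TensorProduct.includeLeft_apply,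
      Algebra.TensorProduct.includeRight_apply, mul_sub, sub_mul, mul_smul_comm, smul_mul_assoc,
      Algebra.TensorProduct.tmul_mul_tmul, one_mul, mul_one, mul_add, add_mul, k_mul_k,
      QAlg.ω_mul_f, TensorProduct.sub_tmul,
      TensorProduct.add_tmul, TensorProduct.tmul_neg, Algebra.TensorProduct.one_def]
    module

/-- The linear map `H(N)* → Q(N, β)`, `φ ↦ (φ ⊗ id)(R')`. -/
noncomputable def dualToQ : Module.Dual ℂ (HAlg N) →ₗ[ℂ] QAlg N β := contract (mixedR N β)

theorem dualToQ_dualMul (φ ψ : Module.Dual ℂ (HAlg N)) :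
    dualToQ N β (DrinfeldDouble.dualMul ℂ _ φ ψ) = dualToQ N β φ * dualToQ N β ψ := by
  rw [dualToQ, ← contract_legs, ← mixedR_comul]
  exact (contract_rTensor (comulHom N).toLinearMap (mixedR N β)
    (TensorProduct.dualDistrib ℂ _ _ (φ ⊗ₜ ψ))).symm

variable {N} in
-- For a character the contraction is itself an algebra map, so it can be computed on R' factor by
-- factor.
theorem dualToQ_algHom (χ : HAlg N →ₐ[ℂ] ℂ) :
    dualToQ N β χ.toLinearMap
      = Algebra.TensorProduct.lid ℂ _
          (Algebra.TensorProduct.map χ (AlgHom.id ℂ _) (mixedR N β)) := by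
  rw [dualToQ]
  induction mixedR N β with
  | zero => simp
  | add S T hS hT => simp only [map_add, LinearMap.add_apply, hS, hT]
  | tmul a b => simp

theorem dualToQ_counit : dualToQ N β (Coalgebra.counit : HAlg N →ₗ[ℂ] ℂ) = 1 := by
  refine (dualToQ_algHom β (counitHom N)).trans ?_
  have h : ∀ i : Fin N, Algebra.TensorProduct.map (counitHom N) (AlgHom.id ℂ (QAlg N β))
      (mixedFactor β i) = 1 := fun i => by
    simp [mixedFactor, Algebra.TensorProduct.one_def]
  simp only [mixedR, map_mul, map_list_prod, List.map_map, Function.comp_def, h]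
  simp [mixedCartan, smul_smul]
  norm_num

/-- The character k ↦ -1, fᵢ ↦ 0 kills every nilpotent term and leaves only the ω₊ summand of the
Cartan part. -/
theorem dualToQ_character :
    ∃ φ, dualToQ N β φ = QAlg.ω N β true := by
  let χ : HAlg N →ₐ[ℂ] ℂ := lift (-1) (fun _ => 0) (by simp) (by simp) (by simp)
  refine ⟨χ.toLinearMap, (dualToQ_algHom β χ).trans ?_⟩
  have h : ∀ i : Fin N, Algebra.TensorProduct.map χ (AlgHom.id ℂ (QAlg N β))
      (mixedFactor β i) = 1 := fun i => by
    simp [mixedFactor, Algebra.TensorProduct.one_def, χ]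
  simp only [mixedR, map_mul, map_list_prod, List.map_map, Function.comp_def, h]
  simp [mixedCartan, χ, smul_smul]
  norm_num

theorem dualToQ_skewPrimitive (i : Fin N) :
    ∃ φ, dualToQ N β φ = QAlg.f true i := by
  -- A two-dimensional representation seeing only k and fᵢ. Under it R' becomes (E₁₁ ⊗ 1 + E₂₂ ⊗
  -- ω₊)(1 - 2E₁₂ ⊗ fᵢ⁺), whose upper right entry is -2fᵢ⁺. This explains the scalar -1/2 below.
  let ρ : HAlg N →ₐ[ℂ] Matrix (Fin 2) (Fin 2) ℂ :=
    lift !![1, 0; 0, -1] (fun j => if j = i then !![0, 1; 0, 0] else 0)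
      (by intro a b; split_ifs <;> ext x y <;> fin_cases x <;> fin_cases y <;> simp)
      (by intro a; split_ifs <;> ext x y <;> fin_cases x <;> fin_cases y <;> simp)
      (by simp [Matrix.one_fin_two])
  let F : HAlg N ⊗[ℂ] QAlg N β →ₐ[ℂ] Matrix (Fin 2) (Fin 2) ℂ ⊗[ℂ] QAlg N β :=
    Algebra.TensorProduct.map ρ (AlgHom.id ℂ _)
  let φ₀ : Module.Dual ℂ (Matrix (Fin 2) (Fin 2) ℂ) := Matrix.entryLinearMap ℂ ℂ 0 1
  have hF : F (mixedR N β) = F (mixedCartan N β) * F (mixedFactor β i) := by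
    rw [mixedR, map_mul, map_list_prod, List.map_map]
    congr 1
    refine List.prod_map_eq_pow_single i _ ?_ |>.trans ?_
    · intro j hj _
      simp [F, mixedFactor, ρ, hj, Algebra.TensorProduct.one_def]
    · rw [List.count_eq_one_of_mem (List.nodup_finRange N) (List.mem_finRange i), pow_one]
      rfl
  refine ⟨(-1 / 2 : ℂ) • (φ₀ ∘ₗ ρ.toLinearMap), ?_⟩
  rw [map_smul, dualToQ, ← contract_rTensor]
  have h : contract (F (mixedR N β)) φ₀ = (-2 : ℂ) • QAlg.f true i := by
    rw [hF]
    simp [F, mixedCartan, mixedFactor, ρ, mul_sub, add_mul, φ₀, Matrix.one_fin_two, smul_mul_assoc,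
      mul_smul_comm]
    module
  refine (congrArg _ h).trans ?_
  rw [smul_smul]
  norm_num

end

end HAlg

/-! ## The linear map `φ ⊗ a ↦ u(φ) v(a)` is multiplicative -/

namespace HAlg

open DrinfeldDouble

section

variable {N : ℕ}

theorem antipodeLin_antipodeInv (a : HAlg N) : antipodeLin N (antipodeInv ℂ _ a) = a :=
  (LinearEquiv.ofBijective (HopfAlgebra.antipode ℂ : HAlg N →ₗ[ℂ] HAlg N)
    HasBijectiveAntipode.bijective).apply_symm_apply a

theorem antipodeInv_antipodeLin (a : HAlg N) : antipodeInv ℂ _ (antipodeLin N a) = a :=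
  (LinearEquiv.ofBijective (HopfAlgebra.antipode ℂ : HAlg N →ₗ[ℂ] HAlg N)
    HasBijectiveAntipode.bijective).symm_apply_apply a

theorem antipodeLin_injective : Function.Injective (antipodeLin N) :=
  Function.LeftInverse.injective antipodeInv_antipodeLin

theorem antipodeInv_mul (a b : HAlg N) :
    antipodeInv ℂ _ (a * b) = antipodeInv ℂ _ b * antipodeInv ℂ _ a :=
  antipodeLin_injective (by simp only [antipodeLin_mul, antipodeLin_antipodeInv])

theorem antipodeInv_one : antipodeInv ℂ _ (1 : HAlg N) = 1 :=
  antipodeLin_injective (by simp only [antipodeLin_antipodeInv, antipodeLin_one])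

theorem antipodeInv_k : antipodeInv ℂ _ (k N) = k N :=
  antipodeLin_injective (by simp only [antipodeLin_antipodeInv, antipodeLin_k])

theorem antipodeInv_f (i : Fin N) : antipodeInv ℂ _ (f i) = f i * k N :=
  antipodeLin_injective (by
    simp [antipodeLin_antipodeInv, antipodeLin_mul, ← mul_assoc, k_mul_f]
    simp [mul_assoc, k_mul_k])

/-- `∑ S⁻¹(a'') a' = ε(a) 1`. -/
theorem antipodeInv_comul (a : HAlg N) :
    LinearMap.mul' ℂ _ (TensorProduct.comm ℂ _ _
      ((antipodeInv ℂ (HAlg N)).lTensor _ (comulHom N a))) = algebraMap ℂ _ (counitHom N a) := by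
  -- Applying the antimultiplicative S turns S⁻¹(a'')a' into S(a')a'', so the claim becomes the
  -- usual antipode axiom.
  have h : ∀ z : HAlg N ⊗[ℂ] HAlg N,
      antipodeLin N (LinearMap.mul' ℂ _ (TensorProduct.comm ℂ _ _
        ((antipodeInv ℂ (HAlg N)).lTensor _ z)))
      = LinearMap.mul' ℂ _ ((antipodeLin N).rTensor _ z) := by
    intro z
    induction z with
    | zero => simp
    | add y z hy hz => simp only [map_add, hy, hz]
    | tmul x y => simp [antipodeLin_mul, antipodeLin_antipodeInv]
  refine antipodeLin_injective ((h _).trans ?_)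
  rw [antipodeLin_algebraMap]
  exact HopfAlgebra.mul_antipode_rTensor_comul_apply (R := ℂ) a

end

section

variable (N : ℕ) (β : ℂ)

/-- `(z ⊗ w) ↦ (S⁻¹(w) ⊗ 1) G(z)`. -/
noncomputable def antipodeInvAct (G : HAlg N ⊗[ℂ] HAlg N →ₗ[ℂ] HAlg N ⊗[ℂ] QAlg N β) :
    (HAlg N ⊗[ℂ] HAlg N) ⊗[ℂ] HAlg N →ₗ[ℂ] HAlg N ⊗[ℂ] QAlg N β :=
  TensorProduct.lift ((LinearMap.mul ℂ (HAlg N ⊗[ℂ] QAlg N β)).flip.compl₁₂ G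
    ((TensorProduct.mk ℂ (HAlg N) (QAlg N β)).flip 1 ∘ₗ antipodeInv ℂ (HAlg N)))

@[simp] theorem antipodeInvAct_tmul
    (G : HAlg N ⊗[ℂ] HAlg N →ₗ[ℂ] HAlg N ⊗[ℂ] QAlg N β) (z : HAlg N ⊗[ℂ] HAlg N) (w : HAlg N) :
    antipodeInvAct N β G (z ⊗ₜ w) = (antipodeInv ℂ (HAlg N) w ⊗ₜ 1) * G z := rfl

/-- In Sweedler form: ∑ (S⁻¹(a''') ⊗ 1) R' (a' ⊗ v(a'')) = (1 ⊗ v(a)) R'. The intertwining relation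
on the first two coproduct legs turns the left side into ∑ (S⁻¹(a''')a'' ⊗ v(a')) R'. After
rebracketing by coassociativity, the first leg collapses to a counit. -/
theorem antipodeInvAct_mixedR (a : HAlg N) :
    antipodeInvAct N β (LinearMap.mulLeft ℂ (mixedR N β)
        ∘ₗ (Algebra.TensorProduct.map (AlgHom.id ℂ _) (toQ N β)).toLinearMap)
      ((TensorProduct.assoc ℂ _ _ _).symm (comul₃ ℂ (HAlg N) a))
      = (1 ⊗ₜ toQ N β a) * mixedR N β := by
  set G : HAlg N ⊗[ℂ] HAlg N →ₗ[ℂ] HAlg N ⊗[ℂ] QAlg N β :=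
    (Algebra.TensorProduct.map (AlgHom.id ℂ _) (toQ N β)).toLinearMap
      ∘ₗ (TensorProduct.comm ℂ (HAlg N) (HAlg N)).toLinearMap with hG
  have h1 : ∀ t : HAlg N ⊗[ℂ] HAlg N,
      antipodeInvAct N β (LinearMap.mulLeft ℂ (mixedR N β)
        ∘ₗ (Algebra.TensorProduct.map (AlgHom.id ℂ _) (toQ N β)).toLinearMap)
        ((Coalgebra.comul (R := ℂ)).rTensor _ t)
      = antipodeInvAct N β G ((Coalgebra.comul (R := ℂ)).rTensor _ t) * mixedR N β := by
    intro t
    induction t with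
    | zero => simp
    | add y z hy hz => simp only [map_add, hy, hz, add_mul]
    | tmul x y =>
      simp only [LinearMap.rTensor_tmul, antipodeInvAct_tmul, LinearMap.comp_apply,
        LinearMap.mulLeft_apply, mul_assoc]
      congr 1
      exact mixedR_intertwine N β x
  have h2 : ∀ (x : HAlg N) (c : HAlg N ⊗[ℂ] HAlg N),
      antipodeInvAct N β G ((TensorProduct.assoc ℂ _ _ _).symm (x ⊗ₜ c))
        = LinearMap.mul' ℂ _ (TensorProduct.comm ℂ _ _
          ((antipodeInv ℂ (HAlg N)).lTensor _ c)) ⊗ₜ toQ N β x := by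
    intro x c
    induction c with
    | zero => simp
    | add y z hy hz => simp only [map_add, TensorProduct.tmul_add, TensorProduct.add_tmul, hy, hz]
    | tmul y w => simp [hG]
  have h3 : ∀ t : HAlg N ⊗[ℂ] HAlg N,
      antipodeInvAct N β G ((TensorProduct.assoc ℂ _ _ _).symm
        ((Coalgebra.comul (R := ℂ)).lTensor _ t))
      = 1 ⊗ₜ toQ N β (TensorProduct.rid ℂ _ ((Coalgebra.counit (R := ℂ)).lTensor _ t)) := by
    intro t
    induction t with
    | zero => simp
    | add y z hy hz => simp only [map_add, hy, hz, TensorProduct.tmul_add]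
    | tmul x y =>
      rw [LinearMap.lTensor_tmul, h2, comul_apply, antipodeInv_comul, LinearMap.lTensor_tmul,
        TensorProduct.rid_tmul, counit_apply, Algebra.algebraMap_eq_smul_one, map_smul,
        TensorProduct.smul_tmul]
  have h4 : comul₃ ℂ (HAlg N) a = TensorProduct.assoc ℂ _ _ _
      ((Coalgebra.comul (R := ℂ)).rTensor _ (Coalgebra.comul (R := ℂ) a)) :=
    (Coalgebra.coassoc_apply a).symm
  rw [h4, LinearEquiv.symm_apply_apply, h1, ← LinearEquiv.symm_apply_apply
    (TensorProduct.assoc ℂ (HAlg N) (HAlg N) (HAlg N)) (LinearMap.rTensor _ _ _), ← h4]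
  simp only [comul₃, LinearMap.comp_apply]
  rw [h3, Coalgebra.lTensor_counit_comul]
  simp

/-- The linear map `D(H(N)) → Q(N, β)`, `φ ⊗ a ↦ u(φ) v(a)`. -/
noncomputable def doubleToQ : DrinfeldDouble ℂ (HAlg N) →ₗ[ℂ] QAlg N β :=
  TensorProduct.lift ((LinearMap.mul ℂ (QAlg N β)).compl₁₂ (dualToQ N β) (toQ N β).toLinearMap)

@[simp] theorem doubleToQ_tmul (φ : Module.Dual ℂ (HAlg N)) (a : HAlg N) :
    doubleToQ N β (φ ⊗ₜ a) = dualToQ N β φ * toQ N β a := rfl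

/-- Contracting `antipodeInvAct_mixedR` with ψ translates ψ by S⁻¹(a''') and a' on one side and
gives v(a)u(ψ) on the other. -/
theorem doubleToQ_straighten (a b : HAlg N) (ψ : Module.Dual ℂ (HAlg N)) :
    doubleToQ N β (straighten ℂ _ a (ψ ⊗ₜ b)) = toQ N β a * dualToQ N β ψ * toQ N β b := by
  have h1 : ∀ t : HAlg N ⊗[ℂ] (HAlg N ⊗[ℂ] HAlg N),
      doubleToQ N β (TensorProduct.lift
        (TensorProduct.uncurry (RingHom.id ℂ) (HAlg N) (HAlg N) _ ∘ₗ straightenAux ℂ (HAlg N)) t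
          (ψ ⊗ₜ b))
      = contract (antipodeInvAct N β (LinearMap.mulLeft ℂ (mixedR N β)
        ∘ₗ (Algebra.TensorProduct.map (AlgHom.id ℂ _) (toQ N β)).toLinearMap)
        ((TensorProduct.assoc ℂ _ _ _).symm t)) ψ * toQ N β b := by
    intro t
    induction t with
    | zero => simp
    | add y z hy hz => simp only [map_add, LinearMap.add_apply, hy, hz, add_mul]
    | tmul x y =>
      induction y with
      | zero => simp
      | add y z hy hz =>
        simp only [map_add, TensorProduct.tmul_add, LinearMap.add_apply, hy, hz, add_mul]
      | tmul y w =>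
        simp only [TensorProduct.lift.tmul, LinearMap.comp_apply, TensorProduct.uncurry_apply,
          straightenAux_apply, doubleToQ_tmul, map_mul, TensorProduct.assoc_symm_tmul,
          antipodeInvAct_tmul, AlgHom.toLinearMap_apply, Algebra.TensorProduct.map_tmul,
          AlgHom.id_apply, LinearMap.mulLeft_apply]
        rw [contract_translate (antipodeInv ℂ (HAlg N) w) x _ _ ψ
          (translate ℂ (HAlg N) (antipodeInv ℂ (HAlg N) w) x ψ) (fun _ => rfl), ← mul_assoc]
        rfl
  refine (h1 _).trans ?_
  rw [antipodeInvAct_mixedR, dualToQ]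
  congr 1
  induction mixedR N β with
  | zero => simp
  | add y z hy hz => simp only [map_add, LinearMap.add_apply, hy, hz, mul_add]
  | tmul x y => simp

theorem doubleToQ_mul (x y : DrinfeldDouble ℂ (HAlg N)) :
    doubleToQ N β (mul ℂ _ x y) = doubleToQ N β x * doubleToQ N β y := by
  induction x using TensorProduct.induction_on with
  | zero => simp
  | add x z hx hz => simp only [map_add, LinearMap.add_apply, hx, hz, add_mul]
  | tmul φ a =>
    induction y using TensorProduct.induction_on with
    | zero => simp
    | add y z hy hz => simp only [map_add, hy, hz, mul_add]
    | tmul ψ b =>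
      have h : ∀ z, doubleToQ N β ((dualMul ℂ _ φ).rTensor _ z)
          = dualToQ N β φ * doubleToQ N β z := by
        intro z
        induction z with
        | zero => simp
        | add y z hy hz => simp only [map_add, hy, hz, mul_add]
        | tmul ψ b => simp [dualToQ_dualMul, mul_assoc]
      refine (h _).trans ?_
      rw [doubleToQ_straighten, doubleToQ_tmul, doubleToQ_tmul]
      simp only [mul_assoc]

theorem doubleToQ_inclH (a : HAlg N) : doubleToQ N β (inclH ℂ _ a) = toQ N β a := by
  refine (doubleToQ_tmul N β _ _).trans ?_
  rw [dualToQ_counit, one_mul]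

theorem doubleToQ_inclDual (φ : Module.Dual ℂ (HAlg N)) :
    doubleToQ N β (inclDual ℂ _ φ) = dualToQ N β φ := by
  refine (doubleToQ_tmul N β _ _).trans ?_
  rw [map_one, mul_one]

/-- The range is closed under sums and products, so generators suffice: ω₊ and fᵢ⁺ come from u, ω₋
and fᵢ⁻ = v(fᵢk) from v. -/
theorem doubleToQ_surjective : Function.Surjective (doubleToQ N β) := by
  intro q
  induction q using QAlg.induction_ω with
  | hc c => exact ⟨inclH ℂ _ (algebraMap ℂ _ c), by rw [doubleToQ_inclH]; simp⟩
  | hω s =>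
    cases s with
    | true =>
      obtain ⟨φ, hφ⟩ := dualToQ_character N β
      exact ⟨inclDual ℂ _ φ, by rw [doubleToQ_inclDual, hφ]⟩
    | false => exact ⟨inclH ℂ _ (k N), by rw [doubleToQ_inclH, toQ_k]⟩
  | hf s i =>
    cases s with
    | true =>
      obtain ⟨φ, hφ⟩ := dualToQ_skewPrimitive N β i
      exact ⟨inclDual ℂ _ φ, by rw [doubleToQ_inclDual, hφ]⟩
    | false =>
      exact ⟨inclH ℂ _ (f i * k N), by
        rw [doubleToQ_inclH, map_mul, toQ_k, toQ_f, mul_assoc, QAlg.ω_mul_self, mul_one]⟩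
  | hmul a b ha hb =>
    obtain ⟨x, rfl⟩ := ha
    obtain ⟨y, rfl⟩ := hb
    exact ⟨_, doubleToQ_mul N β x y⟩
  | hadd a b ha hb =>
    obtain ⟨x, rfl⟩ := ha
    obtain ⟨y, rfl⟩ := hb
    exact ⟨x + y, map_add _ _ _⟩

end

end HAlg

/-! ## Dimensions -/

theorem ExteriorAlgebra.finrank_eq {K M : Type*} [Field K] [AddCommGroup M] [Module K M]
    [FiniteDimensional K M] :
    Module.finrank K (ExteriorAlgebra K M) = 2 ^ Module.finrank K M := by
  rw [Module.finrank_eq_card_basis (Module.finBasis K M).ExteriorAlgebra, Fintype.card_finset,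
    Fintype.card_fin]

theorem CliffordAlgebra.finrank_eq {K M : Type*} [Field K] [AddCommGroup M] [Module K M]
    [FiniteDimensional K M] [Invertible (2 : K)] (q : QuadraticForm K M) :
    Module.finrank K (CliffordAlgebra q) = 2 ^ Module.finrank K M := by
  rw [(CliffordAlgebra.equivExterior q).finrank_eq, ExteriorAlgebra.finrank_eq]

instance ExteriorAlgebra.finiteDimensional {K M : Type*} [Field K] [AddCommGroup M] [Module K M]
    [FiniteDimensional K M] : FiniteDimensional K (ExteriorAlgebra K M) :=
  Module.Finite.of_basis (Module.finBasis K M).ExteriorAlgebra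

theorem CliffordAlgebra.finiteDimensional {K M : Type*} [Field K] [AddCommGroup M] [Module K M]
    [FiniteDimensional K M] [Invertible (2 : K)] (q : QuadraticForm K M) :
    FiniteDimensional K (CliffordAlgebra q) :=
  Module.Finite.equiv (CliffordAlgebra.equivExterior q).symm

/-! ### Upper bound for the dimension of H(N) -/

namespace HAlg

variable (N : ℕ)

/-- The algebra map from the exterior algebra on the `fᵢ`. -/
noncomputable def ofExterior : ExteriorAlgebra ℂ (Fin N → ℂ) →ₐ[ℂ] HAlg N :=
  ExteriorAlgebra.lift ℂ ⟨Fintype.linearCombination ℂ f, fun m => by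
    have h : ∀ x y : Fin N → ℂ, Fintype.linearCombination ℂ f x * Fintype.linearCombination ℂ f y
        = -(Fintype.linearCombination ℂ f y * Fintype.linearCombination ℂ f x : HAlg N) := by
      intro x y
      simp only [Fintype.linearCombination_apply, Finset.sum_mul_sum]
      rw [Finset.sum_comm, ← Finset.sum_neg_distrib]
      refine Finset.sum_congr rfl fun i _ => ?_
      rw [← Finset.sum_neg_distrib]
      refine Finset.sum_congr rfl fun j _ => ?_
      rw [smul_mul_smul_comm, smul_mul_smul_comm, f_mul_f_swap i j, smul_neg, mul_comm]
    have h' := eq_neg_iff_add_eq_zero.mp (h m m)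
    rw [← two_smul ℂ] at h'
    exact (smul_eq_zero.mp h').resolve_left two_ne_zero⟩

theorem ofExterior_ι (m : Fin N → ℂ) :
    ofExterior N (ExteriorAlgebra.ι ℂ m) = Fintype.linearCombination ℂ f m :=
  ExteriorAlgebra.lift_ι_apply ℂ _ _ m

/-- Moving k across applies the grading involution to x. For the spanning argument only the
existence of some y matters. -/
theorem k_mul_ofExterior (x : ExteriorAlgebra ℂ (Fin N → ℂ)) :
    ∃ y, k N * ofExterior N x = ofExterior N y * k N := by
  induction x using ExteriorAlgebra.induction with
  | algebraMap r => exact ⟨algebraMap ℂ _ r, by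
      rw [AlgHom.commutes, Algebra.commutes]⟩
  | ι m =>
    refine ⟨-ExteriorAlgebra.ι ℂ m, ?_⟩
    simp [ofExterior_ι, Fintype.linearCombination_apply, Finset.mul_sum, Finset.sum_mul, k_mul_f]
  | mul a b ha hb =>
    obtain ⟨x, hx⟩ := ha
    obtain ⟨y, hy⟩ := hb
    exact ⟨x * y, by rw [map_mul, ← mul_assoc, hx, mul_assoc, hy, map_mul, mul_assoc]⟩
  | add a b ha hb =>
    obtain ⟨x, hx⟩ := ha
    obtain ⟨y, hy⟩ := hb
    exact ⟨x + y, by rw [map_add, mul_add, hx, hy, map_add, add_mul]⟩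

/-- The subspace Λ + Λk, with Λ the image of the exterior algebra, contains 1 and is stable under
left multiplication by generators, hence is everything. -/
theorem exists_ofExterior (a : HAlg N) :
    ∃ x y, ofExterior N x + ofExterior N y * k N = a := by
  suffices h : ∀ a x y, ∃ x' y', ofExterior N x' + ofExterior N y' * k N
      = a * (ofExterior N x + ofExterior N y * k N) by
    simpa using h a 1 0
  intro a
  induction a using induction with
  | hc c =>
    intro x y
    exact ⟨c • x, c • y, by simp [Algebra.algebraMap_eq_smul_one]⟩
  | hk =>
    intro x y
    obtain ⟨x', hx⟩ := k_mul_ofExterior N x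
    obtain ⟨y', hy⟩ := k_mul_ofExterior N y
    refine ⟨y', x', ?_⟩
    rw [mul_add, hx, ← mul_assoc, hy, mul_assoc, k_mul_k, mul_one, add_comm]
  | hf i =>
    intro x y
    have h : f i = ofExterior N (ExteriorAlgebra.ι ℂ (Pi.single i 1)) := by
      rw [ofExterior_ι, Fintype.linearCombination_apply_single, one_smul]
    exact ⟨ExteriorAlgebra.ι ℂ (Pi.single i 1) * x, ExteriorAlgebra.ι ℂ (Pi.single i 1) * y, by
      rw [h, map_mul, map_mul, mul_add, mul_assoc]⟩
  | hmul a b ha hb =>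
    intro x y
    obtain ⟨x', y', h⟩ := hb x y
    obtain ⟨x'', y'', h'⟩ := ha x' y'
    exact ⟨x'', y'', by rw [h', h, mul_assoc]⟩
  | hadd a b ha hb =>
    intro x y
    obtain ⟨x', y', h⟩ := hb x y
    obtain ⟨x'', y'', h'⟩ := ha x y
    exact ⟨x'' + x', y'' + y', by rw [add_mul, ← h, ← h', map_add, map_add, add_mul]; abel⟩

theorem finrank_le : Module.finrank ℂ (HAlg N) ≤ 2 * 2 ^ N := by
  let g : ExteriorAlgebra ℂ (Fin N → ℂ) × ExteriorAlgebra ℂ (Fin N → ℂ) →ₗ[ℂ] HAlg N :=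
    (ofExterior N).toLinearMap.coprod (LinearMap.mulRight ℂ (k N) ∘ₗ (ofExterior N).toLinearMap)
  have hg : Function.Surjective g := fun a => by
    obtain ⟨x, y, h⟩ := exists_ofExterior N a
    exact ⟨(x, y), h⟩
  refine (LinearMap.finrank_le_finrank_of_surjective hg).trans ?_
  rw [Module.finrank_prod, ExteriorAlgebra.finrank_eq, Module.finrank_fin_fun, two_mul]

end HAlg

/-! ### Lower bound for the dimension of Q(N, β) by Clifford modules -/

namespace QAlg

/-- The form `c ∑ᵢ mᵢ⁺ mᵢ⁻`. -/
noncomputable def hypForm (N : ℕ) (c : ℂ) : QuadraticForm ℂ (Bool × Fin N → ℂ) :=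
  LinearMap.BilinMap.toQuadraticMap (LinearMap.mk₂ ℂ
    (fun m m' => c * ∑ i, m (true, i) * m' (false, i))
    (fun _ _ _ => by simp [add_mul, Finset.sum_add_distrib, mul_add])
    (fun r _ _ => by simp [mul_left_comm c, Finset.mul_sum, mul_assoc])
    (fun _ _ _ => by simp [mul_add, Finset.sum_add_distrib])
    (fun r _ _ => by simp [mul_left_comm r, Finset.mul_sum]))

theorem polar_hypForm (N : ℕ) (c : ℂ) (m m' : Bool × Fin N → ℂ) :
    QuadraticMap.polar (hypForm N c) m m'
      = c * ∑ i, m (true, i) * m' (false, i) + c * ∑ i, m' (true, i) * m (false, i) := by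
  rw [hypForm, LinearMap.BilinMap.polar_toQuadraticMap]
  rfl

section

variable {N : ℕ} (β : ℂ) {l : ℂ} (hl : l ^ 4 = 1)

/-- The module of `Q(N, β)` on a Clifford algebra: `fᵢ^±` act by multiplication with the
generators and `K` acts by `l` times the grading involution. -/
noncomputable def cliffordRep :
    QAlg N β →ₐ[ℂ] Module.End ℂ (CliffordAlgebra (hypForm N ((1 - l ^ 2) / 2))) :=
  lift β (l • CliffordAlgebra.involute.toLinearMap)
    (fun s i => LinearMap.mulLeft ℂ (CliffordAlgebra.ι _ (Pi.single (s, i) 1)))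
    (fun s i => by
      ext x
      simp)
    (fun i j => by
      -- The polar form pairs fᵢ⁺ with fⱼ⁻ to δᵢⱼ(1 - l²)/2. This is the scalar by which e₁ must
      -- act, since K² acts by l²: it is 0 for l = ±1 and 1 for l = ±i.
      have h := CliffordAlgebra.ι_mul_ι_add_swap (Q := hypForm N ((1 - l ^ 2) / 2))
        (Pi.single (true, i) 1) (Pi.single (false, j) 1)
      rw [polar_hypForm] at h
      refine LinearMap.ext fun x => ?_
      have h' := congrArg (· * x) h
      simp only [add_mul, mul_assoc] at h'
      refine h'.trans ?_
      by_cases hij : i = j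
      · subst hij
        simp [Pi.single_apply, pow_two, smul_smul, Algebra.algebraMap_eq_smul_one]
        module
      · have hz : ∀ x : Fin N, ¬(x = j ∧ x = i) := fun x hx => hij (hx.2 ▸ hx.1)
        simp [Pi.single_apply, hij, ← ite_and, hz])
    (fun s i j => by
      have h := CliffordAlgebra.ι_mul_ι_add_swap (Q := hypForm N ((1 - l ^ 2) / 2))
        (Pi.single (s, i) 1) (Pi.single (s, j) 1)
      rw [polar_hypForm] at h
      refine LinearMap.ext fun x => ?_
      have h' := congrArg (· * x) h
      simp only [add_mul, mul_assoc] at h'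
      refine h'.trans ?_
      cases s <;> simp [Pi.single_apply])
    (by
      refine LinearMap.ext fun x => ?_
      have : l * (l * (l * l)) = 1 := by linear_combination hl
      simp [pow_succ, smul_smul, this, mul_assoc])

theorem cliffordRep_K (x : CliffordAlgebra (hypForm N ((1 - l ^ 2) / 2))) :
    cliffordRep β hl (K N β) x = l • CliffordAlgebra.involute x := by
  simp [cliffordRep]

theorem cliffordRep_f (s : Bool) (i : Fin N)
    (x : CliffordAlgebra (hypForm N ((1 - l ^ 2) / 2))) :
    cliffordRep β hl (f s i) x = CliffordAlgebra.ι _ (Pi.single (s, i) 1) * x := by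
  simp [cliffordRep]

theorem cliffordRep_sum (m : Bool × Fin N → ℂ)
    (x : CliffordAlgebra (hypForm N ((1 - l ^ 2) / 2))) :
    cliffordRep β hl (∑ p, m p • f p.1 p.2) x = CliffordAlgebra.ι _ m * x := by
  conv_rhs => rw [pi_eq_sum_univ' m]
  simp only [map_sum, map_smul, LinearMap.sum_apply, LinearMap.smul_apply, cliffordRep_f,
    Finset.sum_mul, smul_mul_assoc]

theorem cliffordRep_K_pow (n : ℕ) :
    cliffordRep β hl (K N β ^ n) 1 = l ^ n • (1 : CliffordAlgebra (hypForm N ((1 - l ^ 2) / 2))) := by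
  induction n with
  | zero => simp
  | succ n ih =>
    rw [pow_succ' (K N β), map_mul, Module.End.mul_apply, ih, map_smul, cliffordRep_K, map_one,
      smul_smul, pow_succ l n]

end

theorem I_pow_pow_four (n : Fin 4) : (Complex.I ^ (n : ℕ)) ^ 4 = 1 := by
  rw [← pow_mul, mul_comm, pow_mul, Complex.I_pow_four, one_pow]

/-- Orthogonality of the characters of ℤ/4, with the inverse l⁻ʲ written as l³ʲ. -/
theorem sum_I_pow (n m : Fin 4) :
    ∑ j : Fin 4, (1 / 4 : ℂ) * (Complex.I ^ (n : ℕ)) ^ (3 * (j : ℕ)) * (Complex.I ^ (m : ℕ)) ^ (j : ℕ)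
      = if m = n then 1 else 0 := by
  have h2 := Complex.I_sq
  have h3 : Complex.I ^ 3 = -Complex.I := Complex.I_pow_three
  have e : ∀ n, Complex.I ^ (n + 4) = Complex.I ^ n := fun n => by
    rw [pow_add, Complex.I_pow_four, mul_one]
  fin_cases n <;> fin_cases m <;>
    simp [Fin.sum_univ_four, h2, h3, e] <;> ring_nf <;> simp [h2, h3] <;> ring_nf

variable (N : ℕ) (β : ℂ)

/-- The action of `Q(N, β)` on the unit vectors of the four Clifford modules. -/
noncomputable def cliffordAct : QAlg N β →ₗ[ℂ]
    (n : Fin 4) → CliffordAlgebra (hypForm N ((1 - (Complex.I ^ (n : ℕ)) ^ 2) / 2)) :=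
  LinearMap.pi fun n => (LinearMap.applyₗ 1) ∘ₗ (cliffordRep β (I_pow_pow_four n)).toLinearMap

theorem cliffordAct_apply (x : QAlg N β) (n : Fin 4) :
    cliffordAct N β x n = cliffordRep β (I_pow_pow_four n) x 1 := rfl

/-- A polynomial in K isolates the unit vector of one Clifford module, and left multiplication by
the fᵢ^± then fills that module without leaving it. -/
theorem cliffordAct_surjective : Function.Surjective (cliffordAct N β) := by
  have h : ∀ (n : Fin 4) x, Pi.single n x ∈ LinearMap.range (cliffordAct N β) := by
    intro n x
    have h1 : Pi.single n 1 ∈ LinearMap.range (cliffordAct N β) := by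
      -- The spectral projector of K for the eigenvalue iⁿ, available because K⁴ = 1. The involution
      -- fixes the unit vector, so K acts on it by a scalar in each module.
      refine ⟨∑ j : Fin 4, ((1 / 4 : ℂ) * (Complex.I ^ (n : ℕ)) ^ (3 * (j : ℕ))) • K N β ^ (j : ℕ),
        funext fun m => ?_⟩
      rw [cliffordAct_apply]
      simp only [map_sum, map_smul, LinearMap.sum_apply, LinearMap.smul_apply, cliffordRep_K_pow,
        smul_smul, ← Finset.sum_smul, sum_I_pow]
      by_cases hmn : m = n
      · subst hmn; simp
      · simp [hmn]
    induction x using CliffordAlgebra.left_induction with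
    | algebraMap r =>
      rw [Algebra.algebraMap_eq_smul_one]
      change LinearMap.single ℂ _ n (r • 1) ∈ _
      rw [map_smul]
      exact Submodule.smul_mem _ _ h1
    | add x y hx hy => rw [Pi.single_add]; exact Submodule.add_mem _ hx hy
    | ι_mul x m hx =>
      obtain ⟨y, hy⟩ := hx
      refine ⟨(∑ p, m p • f p.1 p.2) * y, funext fun j => ?_⟩
      rw [cliffordAct_apply, map_mul, Module.End.mul_apply, cliffordRep_sum, ← cliffordAct_apply,
        hy]
      by_cases hjn : j = n
      · subst hjn; simp
      · simp [hjn]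
  intro y
  change y ∈ LinearMap.range (cliffordAct N β)
  rw [← Finset.univ_sum_single y]
  exact Submodule.sum_mem _ fun n _ => h n _

theorem le_finrank [FiniteDimensional ℂ (QAlg N β)] :
    (2 * 2 ^ N) * (2 * 2 ^ N) ≤ Module.finrank ℂ (QAlg N β) := by
  have : Invertible (2 : ℂ) := invertibleOfNonzero two_ne_zero
  have : ∀ c, FiniteDimensional ℂ (CliffordAlgebra (hypForm N c)) :=
    fun c => CliffordAlgebra.finiteDimensional _
  refine le_trans (le_of_eq ?_)
    (LinearMap.finrank_le_finrank_of_surjective (cliffordAct_surjective N β))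
  rw [Module.finrank_pi_fintype]
  simp only [CliffordAlgebra.finrank_eq]
  simp [two_mul, pow_add]
  ring

end QAlg

/-! ### Injectivity by comparison of dimensions -/

namespace HAlg

variable (N : ℕ) (β : ℂ)

theorem doubleToQ_injective : Function.Injective (doubleToQ N β) := by
  have : FiniteDimensional ℂ (QAlg N β) :=
    Module.Finite.of_surjective _ (doubleToQ_surjective N β)
  have h1 : Module.finrank ℂ (DrinfeldDouble ℂ (HAlg N)) ≤ Module.finrank ℂ (QAlg N β) := by
    rw [Module.finrank_tensorProduct, Subspace.dual_finrank_eq]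
    exact (Nat.mul_le_mul (finrank_le N) (finrank_le N)).trans (QAlg.le_finrank N β)
  have h2 := h1.antisymm
    (LinearMap.finrank_le_finrank_of_surjective (doubleToQ_surjective N β))
  exact (LinearMap.injective_iff_surjective_of_finrank_eq_finrank h2).mpr
    (doubleToQ_surjective N β)

/-- The linear bijection `D(H(N)) ≃ Q(N, β)`. -/
noncomputable def doubleEquivQ : DrinfeldDouble ℂ (HAlg N) ≃ₗ[ℂ] QAlg N β :=
  LinearEquiv.ofBijective (doubleToQ N β) ⟨doubleToQ_injective N β, doubleToQ_surjective N β⟩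

end HAlg

namespace HopfData

section

variable {k A : Type*} [CommRing k] [AddCommGroup A] [Module k A] (h : HopfData k A)

theorem mul₂_tmul (a b c d : A) :
    h.mul₂ (a ⊗ₜ b) (c ⊗ₜ d) = h.mul a c ⊗ₜ h.mul b d := by
  rw [mul₂, TensorProduct.map₂_apply_tmul, TensorProduct.map_tmul]

theorem mul₃_tmul (a c : A) (b d : A ⊗[k] A) :
    h.mul₃ (a ⊗ₜ b) (c ⊗ₜ d) = h.mul a c ⊗ₜ h.mul₂ b d := by
  rw [mul₃, TensorProduct.map₂_apply_tmul, TensorProduct.map_tmul]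

end

end HopfData

/-! ## The Hopf algebra structure of `Q(N, β)` for even `N` -/

namespace QAlg

section

variable {N : ℕ} {β : ℂ}

@[simp] theorem comulHom_f (s : Bool) (i : Fin N) :
    comulHom N β (f s i) = f s i ⊗ₜ 1 + ω N β s ⊗ₜ f s i := by
  simp [comulHom, comulF]

/-- Evenness of N enters on the block e₁ ⊗ e₁: there Δ(K) = -K ⊗ K and Δ(e₁) vanishes, while ω_± ⊗
ω_± contributes (±i)² = -1. The signs agree. -/
theorem comulHom_ω (hN : Even N) (s : Bool) : comulHom N β (ω N β s) = ω N β s ⊗ₜ ω N β s := by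
  have hK : comulHom N β (K N β) = K N β ⊗ₜ K N β
      - (2 : ℂ) • ((e₁ N β * K N β) ⊗ₜ (e₁ N β * K N β)) := by
    rw [comulHom, lift_K, comulK, hN.neg_one_pow, Algebra.TensorProduct.tmul_mul_tmul,
      one_add_one_eq_two]
  have hKK : comulHom N β (K N β) * comulHom N β (K N β) = (K N β ^ 2) ⊗ₜ (K N β ^ 2) := by
    rw [← pow_two, comulHom, lift_K, comulK_sq]
  have he : comulHom N β (e₁ N β) = e₁ N β ⊗ₜ 1 + 1 ⊗ₜ e₁ N β - (2 : ℂ) • (e₁ N β ⊗ₜ e₁ N β) := by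
    have h : comulHom N β (e₁ N β) = (1 / 2 : ℂ) • (1 - (K N β ^ 2) ⊗ₜ (K N β ^ 2)) := by
      rw [← hKK, ← map_mul, ← pow_two, ← map_one (comulHom N β), ← map_sub, ← map_smul]
      rfl
    rw [h, K_sq_eq]
    simp only [TensorProduct.sub_tmul, TensorProduct.tmul_sub, Algebra.TensorProduct.one_def,
      ← TensorProduct.smul_tmul', TensorProduct.tmul_smul]
    module
  have hs : (sgn s) ^ 2 = 1 := by cases s <;> simp [sgn]
  have h1 : e₁ N β * (e₁ N β * K N β) = e₁ N β * K N β := by rw [← mul_assoc, e₁_mul_e₁]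
  simp only [ω, e₀_eq, map_mul, map_add, map_sub, map_smul, he, hK, add_mul, sub_mul,
    mul_sub, one_mul, smul_mul_assoc, mul_smul_comm, Algebra.TensorProduct.tmul_mul_tmul,
    h1, TensorProduct.add_tmul, TensorProduct.sub_tmul, TensorProduct.tmul_add,
    TensorProduct.tmul_sub, ← TensorProduct.smul_tmul', TensorProduct.tmul_smul]
  have hc : (sgn s * Complex.I) * (sgn s * Complex.I) = -1 := by
    linear_combination (Complex.I ^ 2) * hs + Complex.I_sq
  linear_combination (norm := module) (-hc) • ((e₁ N β * K N β) ⊗ₜ[ℂ] (e₁ N β * K N β))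

@[simp] theorem counitHom_f (s : Bool) (i : Fin N) : counitHom N β (f s i) = 0 := by
  simp [counitHom]

@[simp] theorem counitHom_ω (s : Bool) : counitHom N β (ω N β s) = 1 := by
  simp [counitHom, ω, e₀, e₁]
  norm_num

theorem antipodeHom_ω (hN : Even N) (s : Bool) :
    antipodeHom N β (ω N β s) = MulOpposite.op (ω N β s) := by
  have hK : antipodeHom N β (K N β) = MulOpposite.op (K N β) := by
    rw [antipodeHom, lift_K, antipodeK, hN.neg_one_pow, one_smul, e₀_add_e₁, one_mul]
  simp only [ω, e₀, e₁, map_mul, map_add, map_smul, map_sub, map_one, map_pow, hK,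
    ← MulOpposite.op_pow, ← MulOpposite.op_one, ← MulOpposite.op_add, ← MulOpposite.op_sub,
    ← MulOpposite.op_smul, ← MulOpposite.op_mul]
  congr 1
  simp only [mul_add, add_mul, mul_smul_comm, smul_mul_assoc, mul_sub, sub_mul, mul_one, one_mul,
    ← pow_succ, ← pow_succ']

theorem antipodeHom_f (hN : Even N) (s : Bool) (i : Fin N) :
    antipodeHom N β (f s i) = MulOpposite.op (f s i * ω N β s) := by
  rw [antipodeHom, lift_f, antipodeF, hN.neg_one_pow, mul_one, ω]

theorem hopfData_antipode (a : QAlg N β) :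
    (hopfData N β).antipode a = (antipodeHom N β a).unop := rfl

theorem hopfData_comul (a : QAlg N β) : (hopfData N β).comul a = comulHom N β a := rfl

theorem hopfData_counit (a : QAlg N β) : (hopfData N β).counit a = counitHom N β a := rfl

theorem hopfData_mul (a b : QAlg N β) : (hopfData N β).mul a b = a * b := rfl

theorem hopfData_one : (hopfData N β).one = 1 := rfl

theorem hopfData_mul₂ (x y : QAlg N β ⊗[ℂ] QAlg N β) : (hopfData N β).mul₂ x y = x * y := by
  have h : (hopfData N β).mul₂ = LinearMap.mul ℂ (QAlg N β ⊗[ℂ] QAlg N β) := by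
    ext
    simp [HopfData.mul₂_tmul, hopfData_mul]
  rw [h, LinearMap.mul_apply']

theorem hopfData_mul₃ (x y : QAlg N β ⊗[ℂ] (QAlg N β ⊗[ℂ] QAlg N β)) :
    (hopfData N β).mul₃ x y = x * y := by
  have h : (hopfData N β).mul₃ = LinearMap.mul ℂ (QAlg N β ⊗[ℂ] (QAlg N β ⊗[ℂ] QAlg N β)) := by
    ext
    simp [HopfData.mul₃_tmul, hopfData_mul, hopfData_mul₂]
  rw [h, LinearMap.mul_apply']

theorem antipode_mul (a b : QAlg N β) : (hopfData N β).antipode (a * b)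
    = (hopfData N β).antipode b * (hopfData N β).antipode a := by
  simp [hopfData_antipode]

/-- Because S is antimultiplicative, the inner sum ∑ S(x')x'' sits between the two legs of y, and a
scalar there factors out. So the antipode axiom passes to products of generators. -/
theorem lift_antipode_rTensor_mul (x y : QAlg N β ⊗[ℂ] QAlg N β) (c : ℂ)
    (hx : TensorProduct.lift (hopfData N β).mul ((hopfData N β).antipode.rTensor _ x) = c • 1) :
    TensorProduct.lift (hopfData N β).mul ((hopfData N β).antipode.rTensor _ (x * y))
      = c • TensorProduct.lift (hopfData N β).mul ((hopfData N β).antipode.rTensor _ y) := by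
  induction y with
  | zero => simp
  | add y z hy hz => rw [mul_add, map_add, map_add, hy, hz, map_add, map_add, smul_add]
  | tmul p q =>
    have key : TensorProduct.lift (hopfData N β).mul
          ((hopfData N β).antipode.rTensor _ (x * p ⊗ₜ[ℂ] q))
        = (hopfData N β).antipode p
          * TensorProduct.lift (hopfData N β).mul ((hopfData N β).antipode.rTensor _ x) * q := by
      clear hx
      induction x with
      | zero => simp
      | add y z hy hz => simp only [add_mul, mul_add, map_add, hy, hz]
      | tmul r s => simp [antipode_mul, hopfData_mul, mul_assoc]
    rw [key, hx]
    simp [hopfData_mul]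

theorem lift_antipode_lTensor_mul (x y : QAlg N β ⊗[ℂ] QAlg N β) (c : ℂ)
    (hy : TensorProduct.lift (hopfData N β).mul ((hopfData N β).antipode.lTensor _ y) = c • 1) :
    TensorProduct.lift (hopfData N β).mul ((hopfData N β).antipode.lTensor _ (x * y))
      = c • TensorProduct.lift (hopfData N β).mul ((hopfData N β).antipode.lTensor _ x) := by
  induction x with
  | zero => simp
  | add y z hy hz => rw [add_mul, map_add, map_add, hy, hz, map_add, map_add, smul_add]
  | tmul p q =>
    have key : TensorProduct.lift (hopfData N β).mul
          ((hopfData N β).antipode.lTensor _ (p ⊗ₜ[ℂ] q * y))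
        = p * TensorProduct.lift (hopfData N β).mul ((hopfData N β).antipode.lTensor _ y)
          * (hopfData N β).antipode q := by
      clear hy
      induction y with
      | zero => simp
      | add y z hy hz => simp only [add_mul, mul_add, map_add, hy, hz]
      | tmul r s => simp [antipode_mul, hopfData_mul, mul_assoc]
    rw [key, hy]
    simp [hopfData_mul]

theorem isAlgebra : (hopfData N β).IsAlgebra :=
  ⟨mul_assoc, one_mul, mul_one⟩

theorem isHopfAlgebra (hN : Even N) : (hopfData N β).IsHopfAlgebra where
  toIsAlgebra := isAlgebra
  coassoc a := by
    have h : ((Algebra.TensorProduct.assoc ℂ ℂ ℂ _ _ _).toAlgHom.comp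
        (Algebra.TensorProduct.map (comulHom N β) (AlgHom.id ℂ _))).comp (comulHom N β)
        = (Algebra.TensorProduct.map (AlgHom.id ℂ _) (comulHom N β)).comp (comulHom N β) :=
      algHom_ext_ω (fun s => by simp [comulHom_ω hN])
        (fun s i => by
          simp [TensorProduct.add_tmul, TensorProduct.tmul_add, Algebra.TensorProduct.one_def,
            comulHom_ω hN, add_assoc])
    exact DFunLike.congr_fun h a
  counit_comul a := by
    have h : ((Algebra.TensorProduct.lid ℂ _).toAlgHom.comp
        (Algebra.TensorProduct.map (counitHom N β) (AlgHom.id ℂ _))).comp (comulHom N β)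
        = AlgHom.id ℂ _ :=
      algHom_ext_ω (fun s => by simp [comulHom_ω hN]) (fun s i => by simp)
    exact DFunLike.congr_fun h a
  comul_counit a := by
    have h : ((Algebra.TensorProduct.rid ℂ ℂ _).toAlgHom.comp
        (Algebra.TensorProduct.map (AlgHom.id ℂ _) (counitHom N β))).comp (comulHom N β)
        = AlgHom.id ℂ _ :=
      algHom_ext_ω (fun s => by simp [comulHom_ω hN]) (fun s i => by simp)
    exact DFunLike.congr_fun h a
  comul_mul a b := (map_mul (comulHom N β) a b).trans (hopfData_mul₂ _ _).symm
  comul_one := map_one (comulHom N β)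
  counit_mul a b := map_mul (counitHom N β) a b
  counit_one := map_one (counitHom N β)
  antipode_left a := by
    rw [hopfData_counit, hopfData_comul, hopfData_one]
    induction a using induction_ω with
    | hc c =>
      simp [Algebra.algebraMap_eq_smul_one, Algebra.TensorProduct.one_def, hopfData_antipode,
        hopfData_mul]
    | hω s =>
      simp [comulHom_ω hN, hopfData_antipode, antipodeHom_ω hN, hopfData_mul, ω_mul_self]
    | hf s i =>
      simp [hopfData_antipode, antipodeHom_ω hN, antipodeHom_f hN, hopfData_mul, ω_mul_f]
    | hmul a b ha hb => rw [map_mul, lift_antipode_rTensor_mul _ _ _ ha, hb, map_mul, mul_smul]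
    | hadd a b ha hb => simp only [map_add, ha, hb, add_smul]
  antipode_right a := by
    rw [hopfData_counit, hopfData_comul, hopfData_one]
    induction a using induction_ω with
    | hc c =>
      simp [Algebra.algebraMap_eq_smul_one, Algebra.TensorProduct.one_def, hopfData_antipode,
        hopfData_mul]
    | hω s =>
      simp [comulHom_ω hN, hopfData_antipode, antipodeHom_ω hN, hopfData_mul, ω_mul_self]
    | hf s i =>
      simp [hopfData_antipode, antipodeHom_f hN, hopfData_mul, ← mul_assoc, ω_mul_f]
      simp [mul_assoc, ω_mul_self]
    | hmul a b ha hb =>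
      rw [map_mul, lift_antipode_lTensor_mul _ _ _ hb, ha, map_mul, mul_comm, mul_smul]
    | hadd a b ha hb => simp only [map_add, ha, hb, add_smul]

/-- K² fixes e₀ and (iK)² = -K² fixes e₁, so the even powers in the correction terms act trivially
on the respective idempotents. -/
theorem coassociator_eq (hN : Even N) (hβ : β ^ 2 = 1) :
    coassociator N β = 1 ⊗ₜ (1 ⊗ₜ 1) ∧ coevalElement N β = 1 := by
  have h0 : ∀ m, Even m → ∀ x y : QAlg N β, x ^ 2 * y = y → x ^ m * y = y := by
    rintro m ⟨n, rfl⟩ x y h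
    rw [← two_mul, pow_mul]
    induction n with
    | zero => simp
    | succ n ih => rw [pow_succ, mul_assoc, h, ih]
  have h1 : K N β ^ N * e₀ N β = e₀ N β := by
    refine h0 _ hN _ _ ?_
    rw [e₀, mul_smul_comm, mul_add, K_sq_mul_K_sq, mul_one, add_comm]
  have h2 : (Complex.I • K N β) ^ N * e₁ N β = e₁ N β := by
    refine h0 _ hN _ _ ?_
    rw [smul_pow, Complex.I_sq, neg_one_smul, K_sq_eq, neg_mul, sub_mul, smul_mul_assoc,
      e₁_mul_e₁, one_mul]
    module
  constructor
  · rw [coassociator, hβ, one_smul, sub_mul, sub_mul, h1, h2]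
    simp
  · rw [coevalElement, hβ, one_smul, h2, e₀_add_e₁]

end

end QAlg

/-! ### Compatibility of v and R' with the Hopf structure of Q(N, β) -/

namespace HAlg

variable {N : ℕ} {β : ℂ}

theorem comulHom_toQ (hN : Even N) (a : HAlg N) :
    QAlg.comulHom N β (toQ N β a)
      = Algebra.TensorProduct.map (toQ N β) (toQ N β) (comulHom N a) := by
  have h : (QAlg.comulHom N β).comp (toQ N β)
      = (Algebra.TensorProduct.map (toQ N β) (toQ N β)).comp (comulHom N) :=
    algHom_ext (by simp [QAlg.comulHom_ω hN])
      (fun i => by simp [QAlg.comulHom_ω hN, add_mul, QAlg.ω_mul_self])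
  exact DFunLike.congr_fun h a

theorem counitHom_toQ (a : HAlg N) : QAlg.counitHom N β (toQ N β a) = counitHom N a := by
  have h : (QAlg.counitHom N β).comp (toQ N β) = counitHom N := algHom_ext (by simp) (by simp)
  exact DFunLike.congr_fun h a

theorem antipodeHom_toQ (hN : Even N) (a : HAlg N) :
    (QAlg.hopfData N β).antipode (toQ N β a) = toQ N β (antipodeLin N a) := by
  induction a using induction with
  | hc c => simp [QAlg.hopfData_antipode]
  | hk => simp [QAlg.hopfData_antipode, QAlg.antipodeHom_ω hN]
  | hf i =>
    simp [QAlg.hopfData_antipode, QAlg.antipodeHom_ω hN, QAlg.antipodeHom_f hN, ← mul_assoc,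
      QAlg.ω_mul_f]
  | hmul a b ha hb => rw [map_mul, QAlg.antipode_mul, ha, hb, antipodeLin_mul, map_mul]
  | hadd a b ha hb => simp only [map_add, ha, hb]

theorem mixedCartan_comulQ (hN : Even N) :
    Algebra.TensorProduct.map (AlgHom.id ℂ _) (QAlg.comulHom N β) (mixedCartan N β)
      = Algebra.TensorProduct.map (AlgHom.id ℂ _) Algebra.TensorProduct.includeRight
          (mixedCartan N β)
        * Algebra.TensorProduct.map (AlgHom.id ℂ _)
          (Algebra.TensorProduct.includeLeft (R := ℂ) (S := ℂ)) (mixedCartan N β) := by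
  simp only [mixedCartan, map_smul, map_add, map_sub, Algebra.TensorProduct.map_tmul, map_one,
    QAlg.comulHom_ω hN, AlgHom.id_apply, Algebra.TensorProduct.includeLeft_apply,
    Algebra.TensorProduct.includeRight_apply, mul_add, add_mul, mul_smul_comm, smul_mul_assoc,
    Algebra.TensorProduct.tmul_mul_tmul, mul_one, one_mul, k_mul_k,
    Algebra.TensorProduct.one_def, TensorProduct.add_tmul, TensorProduct.sub_tmul,
    mul_sub, sub_mul]
  module

/-- `(id ⊗ Δ)(R') = R'₁₃ R'₁₂`. -/
theorem mixedR_comulQ (hN : Even N) :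
    Algebra.TensorProduct.map (AlgHom.id ℂ _) (QAlg.comulHom N β) (mixedR N β)
      = Algebra.TensorProduct.map (AlgHom.id ℂ _) Algebra.TensorProduct.includeRight
          (mixedR N β)
        * Algebra.TensorProduct.map (AlgHom.id ℂ _)
          (Algebra.TensorProduct.includeLeft (R := ℂ) (S := ℂ)) (mixedR N β) := by
  simp only [mixedR, map_mul, map_list_prod, List.map_map, mixedCartan_comulQ hN]
  rw [mul_assoc, mul_assoc]
  congr 1
  -- Mirror image of the computation for the first leg. Here fᵢ anticommutes with k, so passing the
  -- Cartan part inserts ω₊ in the middle leg, and fᵢ² = 0 removes the cross term from the merged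
  -- factor 1 - 2fᵢ ⊗ Δ(fᵢ⁺).
  rw [← mul_assoc (List.prod _), List.prod_map_conj (B := fun i : Fin N =>
    (1 - (2 : ℂ) • (f i ⊗ₜ (QAlg.ω N β true ⊗ₜ QAlg.f true i)) :
      HAlg N ⊗[ℂ] (QAlg N β ⊗[ℂ] QAlg N β))), mul_assoc]
  · congr 1
    rw [← List.prod_map_mul_of_commute]
    · congr 1
      refine List.map_congr_left fun i _ => ?_
      simp only [Function.comp_apply, mixedFactor, map_sub, map_smul, map_one,
        Algebra.TensorProduct.map_tmul, QAlg.comulHom_f, AlgHom.id_apply,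
        Algebra.TensorProduct.includeLeft_apply, mul_sub, sub_mul, mul_smul_comm, smul_mul_assoc,
        Algebra.TensorProduct.tmul_mul_tmul, f_mul_f_self, TensorProduct.zero_tmul,
        ← Algebra.TensorProduct.one_def, one_mul, mul_one, TensorProduct.tmul_add]
      module
    · intro i j
      simp only [Commute, SemiconjBy, Function.comp_apply, mixedFactor, map_sub, map_smul, map_one,
        Algebra.TensorProduct.map_tmul, AlgHom.id_apply, ← Algebra.TensorProduct.one_def,
        Algebra.TensorProduct.includeLeft_apply, mul_sub, sub_mul, mul_smul_comm, smul_mul_assoc,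
        Algebra.TensorProduct.tmul_mul_tmul, one_mul, mul_one, QAlg.ω_mul_f,
        f_mul_f_swap j i, TensorProduct.neg_tmul, TensorProduct.tmul_neg]
      module
  · intro i
    simp only [Function.comp_apply, mixedFactor, mixedCartan, map_sub, map_smul, map_add, map_one,
      Algebra.TensorProduct.map_tmul, AlgHom.id_apply, Algebra.TensorProduct.includeLeft_apply,
      Algebra.TensorProduct.includeRight_apply, mul_sub, sub_mul, mul_smul_comm, smul_mul_assoc,
      Algebra.TensorProduct.tmul_mul_tmul, one_mul, mul_one, mul_add, add_mul, k_mul_f,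
      QAlg.ω_mul_self, TensorProduct.sub_tmul,
      TensorProduct.add_tmul, TensorProduct.neg_tmul, Algebra.TensorProduct.one_def]
    module

variable (N β) in
theorem mixedR_counitQ :
    Algebra.TensorProduct.map (AlgHom.id ℂ _) (QAlg.counitHom N β) (mixedR N β) = 1 := by
  have h : ∀ i : Fin N, Algebra.TensorProduct.map (AlgHom.id ℂ (HAlg N)) (QAlg.counitHom N β)
      (mixedFactor β i) = 1 := fun i => by
    simp [mixedFactor, Algebra.TensorProduct.one_def]
  simp only [mixedR, map_mul, map_list_prod, List.map_map, Function.comp_def, h]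
  simp only [mixedCartan, map_smul, map_add, map_sub, Algebra.TensorProduct.map_tmul, map_one,
    QAlg.counitHom_ω, AlgHom.id_apply, TensorProduct.add_tmul, TensorProduct.sub_tmul,
    Algebra.TensorProduct.one_def, List.map_const', List.prod_replicate]
  rw [← Algebra.TensorProduct.one_def, one_pow, mul_one]
  module

theorem commute_mixedFactor (i j : Fin N) : Commute (mixedFactor β i) (mixedFactor β j) := by
  simp only [Commute, SemiconjBy, mixedFactor, mul_sub, sub_mul, mul_smul_comm, smul_mul_assoc,
    Algebra.TensorProduct.tmul_mul_tmul, one_mul, mul_one, QAlg.f_mul_f_swap true j i,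
    f_mul_f_swap j i, TensorProduct.neg_tmul, TensorProduct.tmul_neg]
  module

/-- `(S⁻¹ ⊗ id)(R') = (id ⊗ S)(R')`. -/
theorem mixedR_antipode (hN : Even N) :
    (DrinfeldDouble.antipodeInv ℂ (HAlg N)).rTensor _ (mixedR N β)
      = (QAlg.hopfData N β).antipode.lTensor _ (mixedR N β) := by
  -- Both sides are compared in H ⊗ Qᵒᵖ, where id ⊗ S becomes multiplicative and S⁻¹ ⊗ id becomes
  -- antimultiplicative. The latter reverses R' = C·∏Xᵢ, and moving C back through the product
  -- converts one map's value on each Xᵢ into the other's. The reversed order of the Xᵢ is harmless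
  -- because they commute.
  let A : HAlg N ⊗[ℂ] QAlg N β →ₐ[ℂ] HAlg N ⊗[ℂ] (QAlg N β)ᵐᵒᵖ :=
    Algebra.TensorProduct.map (AlgHom.id ℂ _) (QAlg.antipodeHom N β)
  let B : HAlg N ⊗[ℂ] QAlg N β →ₗ[ℂ] HAlg N ⊗[ℂ] (QAlg N β)ᵐᵒᵖ :=
    TensorProduct.map (DrinfeldDouble.antipodeInv ℂ (HAlg N))
      (MulOpposite.opLinearEquiv ℂ).toLinearMap
  have hB : ∀ x y, B (x * y) = B y * B x := by
    intro x y
    induction x with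
    | zero => simp
    | add x z hx hz => simp only [add_mul, mul_add, map_add, hx, hz]
    | tmul a b =>
      induction y with
      | zero => simp
      | add y z hy hz => simp only [add_mul, mul_add, map_add, hy, hz]
      | tmul c d => simp [B, antipodeInv_mul]
  have hone : B 1 = 1 := by
    simp [B, Algebra.TensorProduct.one_def, antipodeInv_one]
  have hCA : A (mixedCartan N β) = (1 / 2 : ℂ) • ((1 + k N) ⊗ₜ 1
      + (1 - k N) ⊗ₜ MulOpposite.op (QAlg.ω N β true)) := by
    simp [A, mixedCartan, QAlg.antipodeHom_ω hN]
  have hCB : B (mixedCartan N β) = A (mixedCartan N β) := by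
    rw [hCA]
    simp [B, mixedCartan, antipodeInv_one, antipodeInv_k]
  have hX : ∀ i : Fin N, B (mixedFactor β i) * A (mixedCartan N β)
      = A (mixedCartan N β) * A (mixedFactor β i) := by
    intro i
    have h1 : B (mixedFactor β i) = 1 - (2 : ℂ) • ((f i * k N) ⊗ₜ MulOpposite.op (QAlg.f true i)) := by
      simp [B, mixedFactor, antipodeInv_one, antipodeInv_f, Algebra.TensorProduct.one_def]
    have h2 : A (mixedFactor β i)
        = 1 - (2 : ℂ) • (f i ⊗ₜ MulOpposite.op (QAlg.f true i * QAlg.ω N β true)) := by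
      simp [A, mixedFactor, QAlg.antipodeHom_f hN, Algebra.TensorProduct.one_def]
    rw [h1, h2, hCA]
    simp only [mul_sub, sub_mul, mul_smul_comm, smul_mul_assoc, mul_add, add_mul, one_mul, mul_one,
      Algebra.TensorProduct.tmul_mul_tmul, ← MulOpposite.op_mul, mul_assoc, k_mul_k, k_mul_f,
      QAlg.ω_mul_f, QAlg.ω_mul_self, MulOpposite.op_neg, TensorProduct.add_tmul,
      TensorProduct.sub_tmul, TensorProduct.neg_tmul, TensorProduct.tmul_neg]
    module
  have hP : ∀ l : List (Fin N), B (l.map (mixedFactor β)).prod * A (mixedCartan N β)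
      = A (mixedCartan N β) * A (l.map (mixedFactor β)).prod := by
    intro l
    induction l with
    | nil => simp [hone]
    | cons i t ih =>
      have hc : Commute (mixedFactor β i) (t.map (mixedFactor β)).prod :=
        Commute.list_prod_right _ _ fun x hx => by
          obtain ⟨j, -, rfl⟩ := List.mem_map.mp hx
          exact commute_mixedFactor i j
      rw [List.map_cons, List.prod_cons, hB, mul_assoc, hX, ← mul_assoc, ih, mul_assoc, hc.eq,
        map_mul]
  have h : B (mixedR N β) = A (mixedR N β) := by
    rw [mixedR, hB, hCB, hP, map_mul]
  have hB' : ∀ x, (MulOpposite.opLinearEquiv ℂ).symm.toLinearMap.lTensor _ (B x)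
      = (DrinfeldDouble.antipodeInv ℂ (HAlg N)).rTensor _ x := by
    intro x
    induction x with
    | zero => simp
    | add x y hx hy => simp only [map_add, hx, hy]
    | tmul a b => simp [B]
  have hA' : ∀ x, (MulOpposite.opLinearEquiv ℂ).symm.toLinearMap.lTensor _ (A x)
      = (QAlg.hopfData N β).antipode.lTensor _ x := by
    intro x
    induction x with
    | zero => simp
    | add x y hx hy => simp only [map_add, hx, hy]
    | tmul a b => simp [A, QAlg.hopfData_antipode]
  rw [← hB', ← hA', h]

end HAlg

/-! ## Transport of structure along isomorphisms -/

namespace HopfData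

section

variable {k A B : Type*} [CommRing k] [AddCommGroup A] [Module k A] [AddCommGroup B] [Module k B]
  {h : HopfData k A} {h' : HopfData k B} {e : A ≃ₗ[k] B}

theorem IsAlgebraIso.isAlgebra (he : IsAlgebraIso h h' e) (H : h'.IsAlgebra) : h.IsAlgebra where
  mul_assoc a b c := e.injective (by simp only [he.map_mul, H.mul_assoc])
  one_mul a := e.injective (by rw [he.map_mul, he.map_one, H.one_mul])
  mul_one a := e.injective (by rw [he.map_mul, he.map_one, H.mul_one])

variable (e) in
/-- `e ⊗ (e ⊗ e)`. -/
noncomputable def congr₃ : A ⊗[k] (A ⊗[k] A) ≃ₗ[k] B ⊗[k] (B ⊗[k] B) :=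
  TensorProduct.congr e (TensorProduct.congr e e)

theorem congr₃_tmul (a : A) (z : A ⊗[k] A) :
    congr₃ e (a ⊗ₜ z) = e a ⊗ₜ TensorProduct.congr e e z := rfl

theorem IsAlgebraIso.map_mul₂ (he : IsAlgebraIso h h' e) (x y : A ⊗[k] A) :
    TensorProduct.congr e e (h.mul₂ x y)
      = h'.mul₂ (TensorProduct.congr e e x) (TensorProduct.congr e e y) := by
  induction x with
  | zero => simp
  | add x z hx hz => simp only [map_add, LinearMap.add_apply, hx, hz]
  | tmul a b =>
    induction y with
    | zero => simp
    | add y z hy hz => simp only [map_add, hy, hz]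
    | tmul c d => simp [mul₂_tmul, he.map_mul]

theorem IsAlgebraIso.map_mul₃ (he : IsAlgebraIso h h' e) (x y : A ⊗[k] (A ⊗[k] A)) :
    congr₃ e (h.mul₃ x y) = h'.mul₃ (congr₃ e x) (congr₃ e y) := by
  induction x with
  | zero => simp
  | add x z hx hz => simp only [map_add, LinearMap.add_apply, hx, hz]
  | tmul a b =>
    induction y with
    | zero => simp
    | add y z hy hz => simp only [map_add, hy, hz]
    | tmul c d => simp only [mul₃_tmul, congr₃_tmul, he.map_mul, he.map_mul₂]

theorem IsHopfIso.congr_comul (he : IsHopfIso h h' e) (a : A) :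
    TensorProduct.congr e e (h.comul a) = h'.comul (e a) := he.map_comul a

theorem IsHopfIso.congr₃_rTensor (he : IsHopfIso h h' e) (z : A ⊗[k] A) :
    congr₃ e (TensorProduct.assoc k A A A (h.comul.rTensor A z))
      = TensorProduct.assoc k B B B (h'.comul.rTensor B (TensorProduct.congr e e z)) := by
  have key : ∀ (w : A ⊗[k] A) (y : A), congr₃ e (TensorProduct.assoc k A A A (w ⊗ₜ y))
      = TensorProduct.assoc k B B B (TensorProduct.congr e e w ⊗ₜ e y) := by
    intro w y
    induction w with
    | zero => simp
    | add x z hx hz => simp only [map_add, TensorProduct.add_tmul, hx, hz]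
    | tmul a b => simp [congr₃_tmul]
  induction z with
  | zero => simp
  | add x z hx hz => simp only [map_add, hx, hz]
  | tmul a b => simp only [LinearMap.rTensor_tmul, key, TensorProduct.congr_tmul, he.congr_comul]

theorem IsHopfIso.congr₃_lTensor (he : IsHopfIso h h' e) (z : A ⊗[k] A) :
    congr₃ e (h.comul.lTensor A z) = h'.comul.lTensor B (TensorProduct.congr e e z) := by
  induction z with
  | zero => simp
  | add x z hx hz => simp only [map_add, hx, hz]
  | tmul a b =>
    simp only [LinearMap.lTensor_tmul, congr₃_tmul, TensorProduct.congr_tmul, he.congr_comul]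

/-- Each axiom holds after applying `e` or its tensor powers, all of which are injective. -/
theorem IsHopfIso.isHopfAlgebra (he : IsHopfIso h h' e) (H : h'.IsHopfAlgebra) :
    h.IsHopfAlgebra where
  toIsAlgebra := he.toIsAlgebraIso.isAlgebra H.toIsAlgebra
  coassoc a := (congr₃ e).injective (by
    rw [he.congr₃_rTensor, he.congr₃_lTensor, he.congr_comul, H.coassoc])
  counit_comul a := e.injective (by
    have key : ∀ z, e (TensorProduct.lid k A (h.counit.rTensor A z))
        = TensorProduct.lid k B (h'.counit.rTensor B (TensorProduct.congr e e z)) := by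
      intro z
      induction z with
      | zero => simp
      | add x z hx hz => simp only [map_add, hx, hz]
      | tmul a b => simp [he.map_counit]
    rw [key, he.congr_comul, H.counit_comul])
  comul_counit a := e.injective (by
    have key : ∀ z, e (TensorProduct.rid k A (h.counit.lTensor A z))
        = TensorProduct.rid k B (h'.counit.lTensor B (TensorProduct.congr e e z)) := by
      intro z
      induction z with
      | zero => simp
      | add x z hx hz => simp only [map_add, hx, hz]
      | tmul a b => simp [he.map_counit]
    rw [key, he.congr_comul, H.comul_counit])
  comul_mul a b := (TensorProduct.congr e e).injective (by
    rw [he.congr_comul, he.map_mul, H.comul_mul, he.map_mul₂, he.congr_comul, he.congr_comul])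
  comul_one := (TensorProduct.congr e e).injective (by
    rw [he.congr_comul, he.map_one, H.comul_one, TensorProduct.congr_tmul, he.map_one])
  counit_mul a b := by
    rw [← he.map_counit, he.map_mul, H.counit_mul, he.map_counit, he.map_counit]
  counit_one := by rw [← he.map_counit, he.map_one, H.counit_one]
  antipode_left a := e.injective (by
    have key : ∀ z, e (TensorProduct.lift h.mul (h.antipode.rTensor A z))
        = TensorProduct.lift h'.mul (h'.antipode.rTensor B (TensorProduct.congr e e z)) := by
      intro z
      induction z with
      | zero => simp
      | add x z hx hz => simp only [map_add, hx, hz]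
      | tmul a b => simp [he.map_mul, he.map_antipode]
    rw [key, he.congr_comul, H.antipode_left, map_smul, he.map_one, he.map_counit])
  antipode_right a := e.injective (by
    have key : ∀ z, e (TensorProduct.lift h.mul (h.antipode.lTensor A z))
        = TensorProduct.lift h'.mul (h'.antipode.lTensor B (TensorProduct.congr e e z)) := by
      intro z
      induction z with
      | zero => simp
      | add x z hx hz => simp only [map_add, hx, hz]
      | tmul a b => simp [he.map_mul, he.map_antipode]
    rw [key, he.congr_comul, H.antipode_right, map_smul, he.map_one, he.map_counit])

theorem IsHopfIso.isQuasiTriangular (he : IsHopfIso h h' e) {R : A ⊗[k] A} {R' : B ⊗[k] B}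
    (hR : TensorProduct.congr e e R = R') (H : h'.IsQuasiTriangular R') :
    h.IsQuasiTriangular R where
  toIsHopfAlgebra := he.isHopfAlgebra H.toIsHopfAlgebra
  invertible := by
    obtain ⟨S, h1, h2⟩ := H.invertible
    refine ⟨(TensorProduct.congr e e).symm S, (TensorProduct.congr e e).injective ?_,
      (TensorProduct.congr e e).injective ?_⟩
    · rw [he.map_mul₂, hR, LinearEquiv.apply_symm_apply, h1, TensorProduct.congr_tmul, he.map_one]
    · rw [he.map_mul₂, hR, LinearEquiv.apply_symm_apply, h2, TensorProduct.congr_tmul, he.map_one]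
  intertwine a := (TensorProduct.congr e e).injective (by
    have key : ∀ z, TensorProduct.congr e e (TensorProduct.comm k A A z)
        = TensorProduct.comm k B B (TensorProduct.congr e e z) := by
      intro z
      induction z with
      | zero => simp
      | add x z hx hz => simp only [map_add, hx, hz]
      | tmul a b => simp
    rw [he.map_mul₂, he.map_mul₂, key, hR, he.congr_comul, H.intertwine])
  hexagon_left := (congr₃ e).injective (by
    have key : ∀ z, congr₃ e (h.leg₁₃ z) = h'.leg₁₃ (TensorProduct.congr e e z) := by
      intro z
      induction z with
      | zero => simp [leg₁₃]
      | add x z hx hz => simpa only [leg₁₃, map_add] using congrArg₂ (· + ·) hx hz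
      | tmul a b => simp [leg₁₃, congr₃_tmul, he.map_one]
    rw [he.congr₃_rTensor, hR, H.hexagon_left, he.map_mul₃, key, hR, leg₂₃, leg₂₃, congr₃_tmul, hR,
      he.map_one])
  hexagon_right := (congr₃ e).injective (by
    have key : ∀ z, congr₃ e (h.leg₁₃ z) = h'.leg₁₃ (TensorProduct.congr e e z) := by
      intro z
      induction z with
      | zero => simp [leg₁₃]
      | add x z hx hz => simpa only [leg₁₃, map_add] using congrArg₂ (· + ·) hx hz
      | tmul a b => simp [leg₁₃, congr₃_tmul, he.map_one]
    have key' : ∀ z, congr₃ e (h.leg₁₂ z) = h'.leg₁₂ (TensorProduct.congr e e z) := by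
      intro z
      induction z with
      | zero => simp [leg₁₂]
      | add x z hx hz => simpa only [leg₁₂, map_add] using congrArg₂ (· + ·) hx hz
      | tmul a b => simp [leg₁₂, congr₃_tmul, he.map_one]
    rw [he.congr₃_lTensor, hR, H.hexagon_right, he.map_mul₃, key, key', hR])

end

end HopfData

/-! ## The isomorphism of Hopf algebras -/

namespace HAlg

open DrinfeldDouble

section

variable (N : ℕ) (β : ℂ)

theorem isAlgebraIso :
    HopfData.IsAlgebraIso (DrinfeldDouble.hopfData ℂ (HAlg N)) (QAlg.hopfData N β)
      (doubleEquivQ N β) where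
  map_mul := doubleToQ_mul N β
  map_one := (doubleToQ_inclH N β 1).trans (map_one _)

variable {N}

/-- Contraction of (id ⊗ Δ)(R') = R'₁₃R'₁₂ with φ. In the product the H-leg belonging to the third
factor stands on the left, which is why the coproduct dual to the opposite multiplication of H
appears. -/
theorem comulHom_dualToQ (hN : Even N) (φ : Module.Dual ℂ (HAlg N)) :
    QAlg.comulHom N β (dualToQ N β φ)
      = TensorProduct.map (dualToQ N β) (dualToQ N β) (dualComul ℂ _ φ) := by
  have h1 : ∀ (S T : HAlg N ⊗[ℂ] QAlg N β)
      (Φ : Module.Dual ℂ (HAlg N) ⊗[ℂ] Module.Dual ℂ (HAlg N)),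
      (∀ x y, TensorProduct.dualDistrib ℂ _ _ Φ (x ⊗ₜ y) = φ (y * x)) →
      contract (Algebra.TensorProduct.map (AlgHom.id ℂ _) Algebra.TensorProduct.includeRight S
        * Algebra.TensorProduct.map (AlgHom.id ℂ _)
          (Algebra.TensorProduct.includeLeft (R := ℂ) (S := ℂ)) T) φ
        = TensorProduct.map (contract T) (contract S) Φ := by
    intro S T Φ hΦ
    induction S with
    | zero => simp
    | add S S' hS hS' => simp only [map_add, add_mul, LinearMap.add_apply, hS, hS',
        TensorProduct.map_add_right]
    | tmul a b =>
      induction T with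
      | zero => simp
      | add S S' hS hS' => simp only [map_add, mul_add, LinearMap.add_apply, hS, hS',
          TensorProduct.map_add_left]
      | tmul c d =>
        simp only [Algebra.TensorProduct.map_tmul, AlgHom.id_apply,
          Algebra.TensorProduct.includeLeft_apply, Algebra.TensorProduct.includeRight_apply,
          Algebra.TensorProduct.tmul_mul_tmul, one_mul, mul_one, contract_tmul, ← hΦ]
        clear hΦ
        induction Φ with
        | zero => simp
        | add Φ Φ' h h' => simp only [map_add, LinearMap.add_apply, add_smul, h, h']
        | tmul ψ χ =>
          simp [← TensorProduct.smul_tmul', smul_smul, mul_comm]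
  have h2 : QAlg.comulHom N β (dualToQ N β φ)
      = contract (Algebra.TensorProduct.map (AlgHom.id ℂ _) (QAlg.comulHom N β) (mixedR N β)) φ :=
    (contract_lTensor (QAlg.comulHom N β).toLinearMap (mixedR N β) φ).symm
  rw [h2, mixedR_comulQ hN, h1 _ _ _ (dualDistrib_dualComul φ)]
  rfl

theorem counitHom_dualToQ (φ : Module.Dual ℂ (HAlg N)) :
    QAlg.counitHom N β (dualToQ N β φ) = φ 1 := by
  have h2 : QAlg.counitHom N β (dualToQ N β φ)
      = contract (Algebra.TensorProduct.map (AlgHom.id ℂ _) (QAlg.counitHom N β) (mixedR N β)) φ :=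
    (contract_lTensor (QAlg.counitHom N β).toLinearMap (mixedR N β) φ).symm
  rw [h2, mixedR_counitQ, Algebra.TensorProduct.one_def, contract_tmul, smul_eq_mul, mul_one]

theorem antipode_dualToQ (hN : Even N) (φ : Module.Dual ℂ (HAlg N)) :
    (QAlg.hopfData N β).antipode (dualToQ N β φ) = dualToQ N β (φ ∘ₗ antipodeInv ℂ (HAlg N)) := by
  rw [dualToQ, ← contract_lTensor, ← mixedR_antipode hN, contract_rTensor]

theorem isHopfIso (hN : Even N) :
    HopfData.IsHopfIso (DrinfeldDouble.hopfData ℂ (HAlg N)) (QAlg.hopfData N β)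
      (doubleEquivQ N β) where
  toIsAlgebraIso := isAlgebraIso N β
  map_comul x := by
    -- Separates the contributions of u and v, so that comultiplicativity of Ψ reduces to that of
    -- each.
    have key : ∀ (Φ : Module.Dual ℂ (HAlg N) ⊗[ℂ] Module.Dual ℂ (HAlg N))
        (t : HAlg N ⊗[ℂ] HAlg N),
        TensorProduct.map (doubleToQ N β) (doubleToQ N β)
          (TensorProduct.tensorTensorTensorComm ℂ _ _ _ _ (Φ ⊗ₜ t))
        = TensorProduct.map (dualToQ N β) (dualToQ N β) Φ
          * Algebra.TensorProduct.map (toQ N β) (toQ N β) t := by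
      intro Φ t
      induction Φ with
      | zero => simp
      | add Φ Φ' h h' => simp only [TensorProduct.add_tmul, map_add, add_mul, h, h']
      | tmul φ ψ =>
        induction t with
        | zero => simp
        | add t t' h h' => simp only [TensorProduct.tmul_add, map_add, mul_add, h, h']
        | tmul a b => simp
    induction x using TensorProduct.induction_on with
    | zero => simp
    | add x y hx hy => simp only [map_add, hx, hy]
    | tmul φ a =>
      refine (key (dualComul ℂ _ φ) (comulHom N a)).trans ?_
      rw [← comulHom_dualToQ β hN, ← comulHom_toQ hN, ← map_mul]
      rfl
  map_counit x := by
    induction x using TensorProduct.induction_on with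
    | zero => simp
    | add x y hx hy => simp only [map_add, hx, hy]
    | tmul φ a =>
      refine (map_mul (QAlg.counitHom N β) (dualToQ N β φ) (toQ N β a)).trans ?_
      rw [counitHom_dualToQ, counitHom_toQ]
      rfl
  map_antipode x := by
    induction x using TensorProduct.induction_on with
    | zero => simp
    | add x y hx hy => simp only [map_add, hx, hy]
    | tmul φ a =>
      refine (doubleToQ_mul N β (inclH ℂ _ (antipodeLin N a))
        (inclDual ℂ _ (φ ∘ₗ antipodeInv ℂ (HAlg N)))).trans ?_
      rw [doubleToQ_inclH, doubleToQ_inclDual, ← antipode_dualToQ β hN, ← antipodeHom_toQ hN,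
        ← QAlg.antipode_mul]
      rfl

end

end HAlg

/-! ## The R-matrix of `Q(N, 1)` -/

namespace QAlg

open HAlg

section

variable {N : ℕ}

/-- Summing over the idempotents absorbs the phases into ω₋ on the left and ω₊ on the right, giving
½(1⊗1 + ω₋⊗1 + 1⊗ω₊ - ω₋⊗ω₊). This needs weight 1 on the block e₁ ⊗ e₁, hence β = 1. -/
theorem rMatrix_eq : rMatrix N 1 = Algebra.TensorProduct.map (toQ N 1) (AlgHom.id ℂ _) (mixedR N 1) := by
  rw [rMatrix, mixedR, map_mul, map_list_prod, List.map_map]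
  congr 1
  · simp only [Fin.sum_univ_two, idem, cartan, mixedCartan, Matrix.cons_val_zero,
      Matrix.cons_val_one, Fin.val_zero, Fin.val_one, one_pow, pow_zero, pow_one, mul_zero,
      mul_one, neg_zero, Nat.cast_zero, Nat.cast_one,
      add_zero, zero_add, zpow_zero, zpow_one, zpow_neg, Complex.inv_I, one_smul, map_smul, map_add,
      map_sub, Algebra.TensorProduct.map_tmul, map_one, toQ_k, AlgHom.id_apply, ω, e₀_eq, sgn,
      smul_mul_assoc, add_mul, sub_mul, mul_sub, one_mul,
      Algebra.TensorProduct.tmul_mul_tmul, TensorProduct.add_tmul, TensorProduct.sub_tmul,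
      TensorProduct.tmul_add, TensorProduct.tmul_sub, ← TensorProduct.smul_tmul',
      TensorProduct.tmul_smul, K_mul_e₁, neg_add_cancel]
    linear_combination (norm := module)
      (-(1 / 2 : ℂ) * Complex.I_sq) • ((e₁ N 1 * K N 1) ⊗ₜ[ℂ] (e₁ N 1 * K N 1))
  · congr 1
    refine List.map_congr_left fun i _ => ?_
    simp [mixedFactor]

theorem rMatrix_mul_comul_toQ (hN : Even N) (h : HAlg N) :
    rMatrix N 1 * comulHom N 1 (toQ N 1 h)
      = Algebra.TensorProduct.comm ℂ _ _ (comulHom N 1 (toQ N 1 h)) * rMatrix N 1 := by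
  have h1 : ∀ z : HAlg N ⊗[ℂ] HAlg N, Algebra.TensorProduct.map (toQ N 1) (toQ N 1) z
      = Algebra.TensorProduct.map (toQ N 1) (AlgHom.id ℂ _)
        (Algebra.TensorProduct.map (AlgHom.id ℂ _) (toQ N 1) z) := by
    intro z
    induction z with
    | zero => simp
    | add x y hx hy => simp only [map_add, hx, hy]
    | tmul a b => simp
  have h2 : ∀ z : HAlg N ⊗[ℂ] HAlg N,
      Algebra.TensorProduct.comm ℂ _ _ (Algebra.TensorProduct.map (toQ N 1) (toQ N 1) z)
      = Algebra.TensorProduct.map (toQ N 1) (toQ N 1) (Algebra.TensorProduct.comm ℂ _ _ z) := by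
    intro z
    induction z with
    | zero => simp
    | add x y hx hy => simp only [map_add, hx, hy]
    | tmul a b => simp
  rw [comulHom_toQ hN, rMatrix_eq, h2, h1, h1, ← map_mul, mixedR_intertwine, map_mul]

theorem rMatrix_mul_ω :
    rMatrix N 1 * (ω N 1 true ⊗ₜ ω N 1 true) = (ω N 1 true ⊗ₜ ω N 1 true) * rMatrix N 1 := by
  rw [rMatrix_eq, mixedR, map_mul, map_list_prod, List.map_map, mul_assoc,
    List.prod_map_conj _ _ (Algebra.TensorProduct.map (toQ N 1) (AlgHom.id ℂ _) ∘ mixedFactor 1),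
    ← mul_assoc, ← mul_assoc]
  · congr 1
    simp only [mixedCartan, map_smul, map_add, map_sub, Algebra.TensorProduct.map_tmul, map_one,
      toQ_k, AlgHom.id_apply, mul_smul_comm, smul_mul_assoc, add_mul, mul_add, sub_mul, mul_sub,
      Algebra.TensorProduct.tmul_mul_tmul, one_mul, mul_one, ω_comm true false]
  · intro i
    have h : ω N 1 true * (f false i * ω N 1 false) = -(f false i * ω N 1 false * ω N 1 true) := by
      rw [← mul_assoc, ω_mul_f, neg_mul, mul_assoc, ω_comm, mul_assoc]
    simp only [Function.comp_apply, mixedFactor, map_sub, map_smul,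
      Algebra.TensorProduct.map_tmul, map_one, toQ_f, AlgHom.id_apply, mul_smul_comm,
      smul_mul_assoc, sub_mul, mul_sub, Algebra.TensorProduct.tmul_mul_tmul, one_mul, mul_one,
      ω_mul_f, h, TensorProduct.neg_tmul, TensorProduct.tmul_neg, neg_neg]

theorem rMatrix_mul_f (i : Fin N) :
    rMatrix N 1 * (f true i ⊗ₜ 1 + ω N 1 true ⊗ₜ f true i)
      = (1 ⊗ₜ f true i + f true i ⊗ₜ ω N 1 true) * rMatrix N 1 := by
  have hff : ∀ j : Fin N, f false j * ω N 1 false * f true i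
      = f true i * (f false j * ω N 1 false) - if j = i then e₁ N 1 * ω N 1 false else 0 := by
    intro j
    rw [mul_assoc, ω_mul_f, mul_neg, ← mul_assoc, f_mul_f_mp, sub_mul, neg_sub, ite_mul, zero_mul,
      mul_assoc]
    simp only [eq_comm]
  have hω : ∀ j : Fin N, ω N 1 true * (f false j * ω N 1 false)
      = -(f false j * ω N 1 false * ω N 1 true) := fun j => by
    rw [← mul_assoc, ω_mul_f, neg_mul, mul_assoc, ω_comm, mul_assoc]
  have hω' : ∀ j : Fin N, ω N 1 false * (f false j * ω N 1 false)
      = -(f false j * ω N 1 false * ω N 1 false) := fun j => by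
    rw [← mul_assoc, ω_mul_f, neg_mul]
  have hcomm : ∀ j, j ≠ i → ∀ s, Commute
      (Algebra.TensorProduct.map (toQ N 1) (AlgHom.id ℂ _) (mixedFactor 1 j))
      (f true i ⊗ₜ 1 + ω N 1 s ⊗ₜ f true i) := by
    intro j hj s
    cases s <;>
    · simp only [Commute, SemiconjBy, mixedFactor, map_sub, map_smul, toQ_f,
        Algebra.TensorProduct.map_tmul, map_one, AlgHom.id_apply, mul_smul_comm, smul_mul_assoc,
        add_mul, mul_add, sub_mul, mul_sub, Algebra.TensorProduct.tmul_mul_tmul, one_mul, mul_one,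
        hff, if_neg hj, sub_zero, hω, hω', f_mul_f_swap true i j, TensorProduct.neg_tmul,
        TensorProduct.tmul_neg]
      module
  -- Here the nilpotent product changes ω₊ into ω₋: reordering fᵢ⁻ω₋ and fᵢ⁺ in the first leg adds
  -- 2e₁ω₋, and ω₊ + 2e₁ω₋ = ω₋. The Cartan part finishes the exchange.
  rw [rMatrix_eq, mixedR, map_mul, map_list_prod, List.map_map, mul_assoc,
    List.prod_map_intertwine (List.nodup_finRange N) _ _
      (f true i ⊗ₜ 1 + ω N 1 false ⊗ₜ f true i) (List.mem_finRange i), ← mul_assoc, ← mul_assoc]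
  · congr 1
    simp only [mixedCartan, map_smul, map_add, map_sub, Algebra.TensorProduct.map_tmul, map_one,
      toQ_k, AlgHom.id_apply, mul_smul_comm, smul_mul_assoc, add_mul, mul_add, sub_mul, mul_sub,
      Algebra.TensorProduct.tmul_mul_tmul, one_mul, mul_one, ω_mul_self, ω_mul_f,
      TensorProduct.add_tmul, TensorProduct.sub_tmul, TensorProduct.neg_tmul,
      TensorProduct.tmul_neg]
    module
  · have h1 : ω N 1 true = ω N 1 false - (2 : ℂ) • (e₁ N 1 * ω N 1 false) := by
      rw [← K_sq_mul_ω, K_sq_eq, sub_mul, one_mul, smul_mul_assoc]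
    simp only [Function.comp_apply, mixedFactor, map_sub, map_smul, toQ_f,
      Algebra.TensorProduct.map_tmul, map_one, AlgHom.id_apply, mul_smul_comm, smul_mul_assoc,
      add_mul, mul_add, sub_mul, mul_sub, Algebra.TensorProduct.tmul_mul_tmul, one_mul, mul_one,
      hff, if_true, f_mul_f_self, TensorProduct.tmul_zero, smul_zero, sub_zero,
      TensorProduct.sub_tmul]
    rw [h1, TensorProduct.sub_tmul, ← TensorProduct.smul_tmul']
    module
  · exact fun j hj => hcomm j hj _
  · exact fun j hj => hcomm j hj _

/-- The relation is multiplicative in a. For ω₋ and fᵢ⁻, which lie in the range of v, it is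
inherited from R'; ω₊ and fᵢ⁺ are handled by direct computation. -/
theorem rMatrix_mul_comul (hN : Even N) (a : QAlg N 1) :
    rMatrix N 1 * comulHom N 1 a
      = Algebra.TensorProduct.comm ℂ _ _ (comulHom N 1 a) * rMatrix N 1 := by
  have hmul : ∀ a b, rMatrix N 1 * comulHom N 1 a
        = Algebra.TensorProduct.comm ℂ _ _ (comulHom N 1 a) * rMatrix N 1 →
      rMatrix N 1 * comulHom N 1 b
        = Algebra.TensorProduct.comm ℂ _ _ (comulHom N 1 b) * rMatrix N 1 →
      rMatrix N 1 * comulHom N 1 (a * b)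
        = Algebra.TensorProduct.comm ℂ _ _ (comulHom N 1 (a * b)) * rMatrix N 1 := by
    intro a b ha hb
    simp only [map_mul]
    rw [← mul_assoc, ha, mul_assoc, hb, mul_assoc]
  induction a using induction_ω with
  | hc c => simpa using rMatrix_mul_comul_toQ hN (algebraMap ℂ _ c)
  | hω s =>
    cases s with
    | true => simpa [comulHom_ω hN] using rMatrix_mul_ω
    | false => simpa using rMatrix_mul_comul_toQ hN (k N)
  | hf s i =>
    cases s with
    | true => simpa using rMatrix_mul_f i
    | false =>
      have h := rMatrix_mul_comul_toQ hN (HAlg.f i * k N)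
      rwa [map_mul, toQ_f, toQ_k, mul_assoc, ω_mul_self, mul_one] at h
  | hmul a b ha hb => exact hmul a b ha hb
  | hadd a b ha hb => simp only [map_add, mul_add, add_mul, ha, hb]

/-- The Cartan part is an involution, and each remaining factor is 1 minus an element of square
zero. -/
theorem isUnit_mixedR : IsUnit (mixedR N 1) := by
  have hC : mixedCartan N 1 * mixedCartan N 1 = 1 := by
    simp only [mixedCartan, mul_smul_comm, smul_mul_assoc, add_mul, mul_add, sub_mul, mul_sub,
      Algebra.TensorProduct.tmul_mul_tmul, one_mul, mul_one, k_mul_k, ω_mul_self,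
      TensorProduct.add_tmul, TensorProduct.sub_tmul, Algebra.TensorProduct.one_def]
    module
  refine IsUnit.mul (isUnit_iff_exists.mpr ⟨_, hC, hC⟩) (List.prod_isUnit ?_)
  intro x hx
  obtain ⟨i, -, rfl⟩ := List.mem_map.mp hx
  refine isUnit_iff_exists.mpr ⟨1 + (2 : ℂ) • (HAlg.f i ⊗ₜ f true i), ?_, ?_⟩ <;>
  · simp only [mixedFactor, mul_smul_comm, smul_mul_assoc, mul_add, mul_sub, sub_mul, add_mul,
      Algebra.TensorProduct.tmul_mul_tmul, one_mul, mul_one, HAlg.f_mul_f_self,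
      TensorProduct.zero_tmul, ← Algebra.TensorProduct.one_def]
    module

theorem isQuasiTriangular (hN : Even N) : (hopfData N 1).IsQuasiTriangular (rMatrix N 1) where
  toIsHopfAlgebra := isHopfAlgebra hN
  invertible := by
    have h : IsUnit (rMatrix N 1) := by
      rw [rMatrix_eq]
      exact isUnit_mixedR.map _
    obtain ⟨S, h1, h2⟩ := isUnit_iff_exists.mp h
    exact ⟨S, by rw [hopfData_mul₂, h1]; rfl, by rw [hopfData_mul₂, h2]; rfl⟩
  intertwine a := by
    rw [hopfData_mul₂, hopfData_mul₂]
    exact rMatrix_mul_comul hN a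
  hexagon_left := by
    rw [hopfData_mul₃, rMatrix_eq]
    -- Since v respects coproducts, this hexagon is the image under v ⊗ v ⊗ id of the coproduct
    -- formula for R' in its first leg.
    have h1 : ∀ z : HAlg N ⊗[ℂ] QAlg N 1, TensorProduct.assoc ℂ _ _ _
        ((hopfData N 1).comul.rTensor _ (Algebra.TensorProduct.map (toQ N 1) (AlgHom.id ℂ _) z))
        = Algebra.TensorProduct.assoc ℂ ℂ ℂ _ _ _ (Algebra.TensorProduct.map
          (Algebra.TensorProduct.map (toQ N 1) (toQ N 1)) (AlgHom.id ℂ _)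
          (Algebra.TensorProduct.map (HAlg.comulHom N) (AlgHom.id ℂ _) z)) := by
      intro z
      induction z with
      | zero => simp
      | add x y hx hy => simp only [map_add, hx, hy]
      | tmul a b =>
        simp only [Algebra.TensorProduct.map_tmul, LinearMap.rTensor_tmul, hopfData_comul,
          comulHom_toQ hN]
        rfl
    rw [h1, mixedR_comul, map_mul, map_mul]
    congr 1
    · generalize mixedR N 1 = z
      induction z with
      | zero => simp [HopfData.leg₁₃]
      | add x y hx hy =>
        simp only [HopfData.leg₁₃, map_add] at hx hy ⊢
        rw [hx, hy]
      | tmul a b => simp [HopfData.leg₁₃, hopfData_one]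
    · generalize mixedR N 1 = z
      induction z with
      | zero => simp [HopfData.leg₂₃]
      | add x y hx hy =>
        simp only [HopfData.leg₂₃, map_add, TensorProduct.tmul_add] at hx hy ⊢
        rw [hx, hy]
      | tmul a b => simp [HopfData.leg₂₃, hopfData_one]
  hexagon_right := by
    rw [hopfData_mul₃, rMatrix_eq]
    have h1 : ∀ z : HAlg N ⊗[ℂ] QAlg N 1,
        (hopfData N 1).comul.lTensor _ (Algebra.TensorProduct.map (toQ N 1) (AlgHom.id ℂ _) z)
        = Algebra.TensorProduct.map (toQ N 1) (AlgHom.id ℂ _)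
          (Algebra.TensorProduct.map (AlgHom.id ℂ _) (comulHom N 1) z) := by
      intro z
      induction z with
      | zero => simp
      | add x y hx hy => simp only [map_add, hx, hy]
      | tmul a b => simp [hopfData_comul]
    rw [h1, mixedR_comulQ hN, map_mul]
    congr 1
    · generalize mixedR N 1 = z
      induction z with
      | zero => simp [HopfData.leg₁₃]
      | add x y hx hy =>
        simp only [HopfData.leg₁₃, map_add] at hx hy ⊢
        rw [hx, hy]
      | tmul a b => simp [HopfData.leg₁₃, hopfData_one]
    · generalize mixedR N 1 = z
      induction z with
      | zero => simp [HopfData.leg₁₂]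
      | add x y hx hy =>
        simp only [HopfData.leg₁₂, map_add] at hx hy ⊢
        rw [hx, hy]
      | tmul a b => simp [HopfData.leg₁₂, hopfData_one]

variable (N) in
-- Ψ restricts to v on H and to u on H*, so the image is ∑ v(bᵢ) ⊗ u(bᵢ*), which is (v ⊗ id)(R') by
-- the dual basis expansion.
theorem map_rMatrix_double :
    TensorProduct.map (doubleEquivQ N 1).toLinearMap (doubleEquivQ N 1).toLinearMap
      (DrinfeldDouble.rMatrix ℂ (HAlg N)) = rMatrix N 1 := by
  have h1 : (doubleEquivQ N 1).toLinearMap ∘ₗ DrinfeldDouble.inclH ℂ (HAlg N)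
      = (toQ N 1).toLinearMap := LinearMap.ext (doubleToQ_inclH N 1)
  have h2 : (doubleEquivQ N 1).toLinearMap ∘ₗ DrinfeldDouble.inclDual ℂ (HAlg N)
      = contract (mixedR N 1) := LinearMap.ext (doubleToQ_inclDual N 1)
  rw [DrinfeldDouble.rMatrix, ← LinearMap.comp_apply, ← TensorProduct.map_comp, h1, h2,
    rMatrix_eq]
  conv_rhs => rw [← sum_contract (mixedR N 1)]
  generalize coevaluation ℂ (HAlg N) 1 = z
  induction z with
  | zero => simp
  | add x y hx hy => simp only [map_add, hx, hy]
  | tmul a b => simp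

end

end QAlg

theorem proposition3p8 (N : ℕ) (hN : 1 ≤ N) (β : ℂ) (hβ : β ^ 4 = (-1) ^ N) :
    ∃ Ψ : DrinfeldDouble ℂ (HAlg N) ≃ₗ[ℂ] QAlg N β,
      ((DrinfeldDouble.hopfData ℂ (HAlg N)).IsAlgebra ∧
        HopfData.IsAlgebraIso (DrinfeldDouble.hopfData ℂ (HAlg N)) (QAlg.hopfData N β) Ψ) ∧
      (Even N → β = 1 ∨ β = -1 →
        QAlg.coassociator N β = 1 ⊗ₜ (1 ⊗ₜ 1) ∧
        QAlg.evalElement N β = 1 ∧ QAlg.coevalElement N β = 1 ∧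
        (QAlg.hopfData N β).IsHopfAlgebra ∧
        (DrinfeldDouble.hopfData ℂ (HAlg N)).IsHopfAlgebra ∧
        HopfData.IsHopfIso (DrinfeldDouble.hopfData ℂ (HAlg N)) (QAlg.hopfData N β) Ψ) ∧
      (Even N → β = 1 →
        (QAlg.hopfData N β).IsQuasiTriangular (QAlg.rMatrix N β) ∧
        (DrinfeldDouble.hopfData ℂ (HAlg N)).IsQuasiTriangular
          (DrinfeldDouble.rMatrix ℂ (HAlg N)) ∧
        TensorProduct.map Ψ.toLinearMap Ψ.toLinearMap (DrinfeldDouble.rMatrix ℂ (HAlg N))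
          = QAlg.rMatrix N β) := by
  refine ⟨HAlg.doubleEquivQ N β,
    ⟨(HAlg.isAlgebraIso N β).isAlgebra QAlg.isAlgebra, HAlg.isAlgebraIso N β⟩, ?_, ?_⟩
  · intro hE hβ'
    have hsq : β ^ 2 = 1 := by rcases hβ' with rfl | rfl <;> norm_num
    obtain ⟨h1, h2⟩ := QAlg.coassociator_eq hE hsq
    exact ⟨h1, rfl, h2, QAlg.isHopfAlgebra hE,
      (HAlg.isHopfIso β hE).isHopfAlgebra (QAlg.isHopfAlgebra hE), HAlg.isHopfIso β hE⟩
  · rintro hE rfl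
    exact ⟨QAlg.isQuasiTriangular hE, (HAlg.isHopfIso 1 hE).isQuasiTriangular
      (QAlg.map_rMatrix_double N) (QAlg.isQuasiTriangular hE), QAlg.map_rMatrix_double N⟩
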